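/- Let $m,k\ge 1$, $\alpha>0$, $1<p<\infty$, $Q=m+(\alpha+1)k$, and write points of $\mathbb R^N=\mathbb R^m\times\mathbb R^k$ as $(z,\sigma)$. Let $\Phi:\mathbb R^m\to[0,\infty)$ and $\Psi:\mathbb R^k\to[0,\infty)$ be Minkowski norms, i.e. $\Phi(\lambda z)=|\lambda|\Phi(z)$ for $\lambda\in\mathbb R$, and $\Phi^2$ is strictly convex and of class $C^2$ on $\mathbb R^m\setminus\{0\}$; likewise for $\Psi$. Let $$\Phi^0(z)=\sup_{\Phi(\zeta)=1}\langle z,\zeta\rangle,\qquad \Theta(z,\sigma)=\left(\Phi(z)^{2(\alpha+1)}+4(\alpha+1)^2\Psi(\sigma)^2\right)^{\frac1{2(\alpha+1)}},$$ and let $\rho\ge 0$ be the anisotropic Legendre transform of $\Theta$, defined by $$\rho(z,\sigma)^{\alpha+1}=\sup_{\Theta(\xi,\tau)=1}\left(|\langle z,\xi\rangle|^{\alpha+1}+4(\alpha+1)^2\langle\sigma,\tau\rangle\right).$$ For a function $u$ put $$\mathscr L_{\alpha,p}(u)=\operatorname{div}_{(z,\sigma)}\mathscr F(u),\qquad \mathscr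 F(u)=\left(\Phi(\nabla_zu)^2+\tfrac{\Phi^0(z)^{2\alpha}}4\Psi(\nabla_\sigma u)^2\right)^{\frac{p-2}2}\begin{pmatrix}\Phi(\nabla_zu)\,\nabla\Phi(\nabla_zu)\\[2pt] \tfrac{\Phi^0(z)^{2\alpha}}4\,\Psi(\nabla_\sigma u)\,\nabla\Psi(\nabla_\sigma u)\end{pmatrix},$$ where $\Phi\nabla\Phi$ and $\Psi\nabla\Psi$ are understood to be $0$ at the origin. **Theorem.** The function $(\Phi^0(z)/\rho)^{\alpha p}$ is integrable over $\{\rho<1\}$, and $$\omega_{\alpha,p}=\int_{\{\rho<1\}}\left(\frac{\Phi^0(z)}{\rho}\right)^{\alpha p}dz\,d\sigma>0.$$ Set $\sigma_{\alpha,p}=Q\,\omega_{\alpha,p}$ and $$C_{\alpha,p}=\begin{cases}\dfrac{p-1}{Q-p}\,\sigma_{\alpha,p}^{-1/(p-1)},&p\ne Q,\\[8pt] \sigma_{\alpha,Q}^{-1/(Q-1)},&p=Q,\end{cases}\qquad \mathscr G_{\alpha,p}=\begin{cases}C_{\alpha,p}\,\rho^{-\frac{Q-p}{p-1}},&p\neq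 Q,\\[4pt] -\,C_{\alpha,p}\log\rho,&p=Q.\end{cases}$$ Then $C_{\alpha,p}>0$ if $p\le Q$, and $\mathscr G_{\alpha,p}$ is a fundamental solution of $-\mathscr L_{\alpha,p}$ with pole at the origin. That is, $\mathscr G_{\alpha,p}\in C^1(\mathbb R^N\setminus\{0\})$, $\mathscr F(\mathscr G_{\alpha,p})\in L^1_{loc}(\mathbb R^N)$, and for every $\varphi\in C_0^\infty(\mathbb R^N)$ $$\int_{\mathbb R^N}\langle\mathscr F(\mathscr G_{\alpha,p}),\nabla_{(z,\sigma)}\varphi\rangle\,dz\,d\sigma=\varphi(0).$$ -/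

import Mathlib

open MeasureTheory
open scoped ContDiff

noncomputable section

namespace AnisoFinsler

/-- A Minkowski norm on `ℝⁿ`: a nonnegative, absolutely one-homogeneous function whose square is
strictly convex and of class `C²` away from the origin.  (Positivity off the origin and the
triangle inequality follow.) -/
structure IsMinkowskiNorm {n : ℕ} (N : EuclideanSpace ℝ (Fin n) → ℝ) : Prop where
  nonneg : ∀ x, 0 ≤ N x
  homogeneous : ∀ (c : ℝ) (x : EuclideanSpace ℝ (Fin n)), N (c • x) = |c| * N x
  strictConvex_sq : StrictConvexOn ℝ Set.univ (fun x => N x ^ 2)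
  contDiffOn_sq : ContDiffOn ℝ 2 (fun x => N x ^ 2) {0}ᶜ

/-- The Legendre transform (dual norm) `N⁰(x) = sup {⟨x, ξ⟩ : N(ξ) = 1}`. -/
def dualNorm {n : ℕ} (N : EuclideanSpace ℝ (Fin n) → ℝ) (x : EuclideanSpace ℝ (Fin n)) : ℝ :=
  sSup ((fun ξ => inner ℝ x ξ) '' {ξ | N ξ = 1})

/-- `ℝᴺ = ℝᵐ × ℝᵏ`, with points `(z, σ)`. -/
abbrev Space (m k : ℕ) : Type := EuclideanSpace ℝ (Fin m) × EuclideanSpace ℝ (Fin k)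

variable {m k : ℕ}

/-- The anisotropic Minkowski gauge
`Θ(z, σ) = (Φ(z)^{2(α+1)} + 4(α+1)² Ψ(σ)²)^{1/(2(α+1))}`. -/
def gauge (α : ℝ) (Φ : EuclideanSpace ℝ (Fin m) → ℝ) (Ψ : EuclideanSpace ℝ (Fin k) → ℝ)
    (x : Space m k) : ℝ :=
  (Φ x.1 ^ (2 * (α + 1)) + 4 * (α + 1) ^ 2 * Ψ x.2 ^ 2) ^ (1 / (2 * (α + 1)))

/-- The anisotropic Legendre transform `ρ = Θ⁰` of `Θ`, given by
`Θ⁰(z, σ)^{α+1} = sup {|⟨z, ξ⟩|^{α+1} + 4(α+1)² ⟨σ, τ⟩ : Θ(ξ, τ) = 1}`. -/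
def dualGauge (α : ℝ) (Φ : EuclideanSpace ℝ (Fin m) → ℝ) (Ψ : EuclideanSpace ℝ (Fin k) → ℝ)
    (x : Space m k) : ℝ :=
  (sSup ((fun y : Space m k =>
      |inner ℝ x.1 y.1| ^ (α + 1) + 4 * (α + 1) ^ 2 * inner ℝ x.2 y.2) ''
    {y | gauge α Φ Ψ y = 1})) ^ (1 / (α + 1))

/-- The homogeneous dimension `Q = m + (α+1) k`. -/
def homDim (m k : ℕ) (α : ℝ) : ℝ := m + (α + 1) * k

/-- The partial gradient `∇_z u`. -/
def gradZ (u : Space m k → ℝ) (x : Space m k) : EuclideanSpace ℝ (Fin m) :=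
  gradient (fun z => u (z, x.2)) x.1

/-- The partial gradient `∇_σ u`. -/
def gradS (u : Space m k → ℝ) (x : Space m k) : EuclideanSpace ℝ (Fin k) :=
  gradient (fun s => u (x.1, s)) x.2

/-- `Φ(∇_z u)² + (Φ⁰(z)^{2α} / 4) Ψ(∇_σ u)²`. -/
def energyDensity (α : ℝ) (Φ : EuclideanSpace ℝ (Fin m) → ℝ)
    (Ψ : EuclideanSpace ℝ (Fin k) → ℝ) (u : Space m k → ℝ) (x : Space m k) : ℝ :=
  Φ (gradZ u x) ^ 2 + dualNorm Φ x.1 ^ (2 * α) / 4 * Ψ (gradS u x) ^ 2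

/-- The vector field
`𝒜(∇u) = (Φ(∇_z u) ∇Φ(∇_z u), (Φ⁰(z)^{2α} / 4) Ψ(∇_σ u) ∇Ψ(∇_σ u))`.
Where `∇_z u = 0` the factor `Φ(∇_z u)` makes the first component `0`, which is the value of
`½ ∇(Φ²)` there; likewise for the second component. -/
def fieldA (α : ℝ) (Φ : EuclideanSpace ℝ (Fin m) → ℝ)
    (Ψ : EuclideanSpace ℝ (Fin k) → ℝ) (u : Space m k → ℝ) (x : Space m k) : Space m k :=
  (Φ (gradZ u x) • gradient Φ (gradZ u x),
   (dualNorm Φ x.1 ^ (2 * α) / 4 * Ψ (gradS u x)) • gradient Ψ (gradS u x))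

/-- The flux of `u`: the vector field whose divergence is `ℒ_{α,p}(u)`. -/
def flux (α p : ℝ) (Φ : EuclideanSpace ℝ (Fin m) → ℝ)
    (Ψ : EuclideanSpace ℝ (Fin k) → ℝ) (u : Space m k → ℝ) (x : Space m k) : Space m k :=
  energyDensity α Φ Ψ u x ^ ((p - 2) / 2) • fieldA α Φ Ψ u x

/-- `u` is a fundamental solution of `-ℒ_{α,p}` with pole at `x₀`: it is `C¹` away from the pole,
its flux is in `L¹_loc(ℝᴺ)`, and `-ℒ_{α,p}(u) = δ_{x₀}` in the weak sense. -/
structure IsFundamentalSolution (α p : ℝ) (Φ : EuclideanSpace ℝ (Fin m) → ℝ)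
    (Ψ : EuclideanSpace ℝ (Fin k) → ℝ) (x₀ : Space m k) (u : Space m k → ℝ) : Prop where
  contDiffOn : ContDiffOn ℝ 1 u {x₀}ᶜ
  locallyIntegrable_flux : LocallyIntegrable (flux α p Φ Ψ u) volume
  weak_eq : ∀ φ : Space m k → ℝ, ContDiff ℝ ∞ φ → HasCompactSupport φ →
    ∫ x, (inner ℝ (flux α p Φ Ψ u x).1 (gradZ φ x) +
      inner ℝ (flux α p Φ Ψ u x).2 (gradS φ x)) = φ x₀

/-- The integrand `(Φ⁰(z) / ρ)^{αp}`. -/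
def weight (α p : ℝ) (Φ : EuclideanSpace ℝ (Fin m) → ℝ)
    (Ψ : EuclideanSpace ℝ (Fin k) → ℝ) (x : Space m k) : ℝ :=
  (dualNorm Φ x.1 / dualGauge α Φ Ψ x) ^ (α * p)

/-- `ω_{α,p} = ∫_{ρ < 1} (Φ⁰(z) / ρ)^{αp} dz dσ`. -/
def omega (α p : ℝ) (Φ : EuclideanSpace ℝ (Fin m) → ℝ)
    (Ψ : EuclideanSpace ℝ (Fin k) → ℝ) : ℝ :=
  ∫ x in {x : Space m k | dualGauge α Φ Ψ x < 1}, weight α p Φ Ψ x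

/-- `σ_{α,p} = Q ω_{α,p}`. -/
def sigma (α p : ℝ) (Φ : EuclideanSpace ℝ (Fin m) → ℝ)
    (Ψ : EuclideanSpace ℝ (Fin k) → ℝ) : ℝ :=
  homDim m k α * omega α p Φ Ψ

open Classical in
/-- The constant `C_{α,p}`. -/
def fundConst (α p : ℝ) (Φ : EuclideanSpace ℝ (Fin m) → ℝ)
    (Ψ : EuclideanSpace ℝ (Fin k) → ℝ) : ℝ :=
  if p = homDim m k α then sigma α p Φ Ψ ^ (-1 / (p - 1))
  else (p - 1) / (homDim m k α - p) * sigma α p Φ Ψ ^ (-1 / (p - 1))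

open Classical in
/-- The function `𝒢_{α,p}`: `C_{α,p} ρ^{-(Q-p)/(p-1)}` for `p ≠ Q`, and `C_{α,p} log (1/ρ)` for
`p = Q`. -/
def fundSol (α p : ℝ) (Φ : EuclideanSpace ℝ (Fin m) → ℝ)
    (Ψ : EuclideanSpace ℝ (Fin k) → ℝ) (x : Space m k) : ℝ :=
  if p = homDim m k α then -(fundConst α p Φ Ψ * Real.log (dualGauge α Φ Ψ x))
  else fundConst α p Φ Ψ *
    dualGauge α Φ Ψ x ^ (-(homDim m k α - p) / (p - 1))

end AnisoFinsler

end

/-!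
# Fundamental solutions of the anisotropic Baouendi–Grushin `p`-Laplacian

The proof rests on two facts.

*The flux of a function of `ρ` is radial.*  The supremum defining `ρ` can be computed:
`ρ^{2(α+1)} = Φ⁰(z)^{2(α+1)} + 4(α+1)² Ψ⁰(σ)²` (`dualGauge_eq`).  Strict convexity makes the
maximizer `S x` of `ζ ↦ ⟨x, ζ⟩ - N(ζ)²/2` unique and continuous in `x` (`legendreMap`); it satisfies
`N⁰(x) = N(S x)`, `∇(N⁰)² = 2 S`, and inverts `N ∇N` (`IsMinkowskiNorm.smul_gradient_legendreMap`).
So if `u` is a function of `ρ`, its partial gradients are multiples of `S z` and `S σ`, and `𝒜(∇u)`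
is a multiple of `X = (z, (α+1) σ)`, the generator of the dilations
`(z, σ) ↦ (eˢ z, e^{(α+1)s} σ)`.  For `u = 𝒢_{α,p}` the exponents and constants combine to
`ℱ(u) = -σ_{α,p}⁻¹ (Φ⁰(z)/ρ)^{αp} ρ^{-Q} X` off the null set `{z = 0}` (`flux_fundSol`).

*Polar coordinates.*  The measure `ν` with density `(Φ⁰(z)/ρ)^{αp} ρ^{-Q}` is invariant under the
dilations.  As each orbit spends unit time in the annulus `A = {1 ≤ ρ < e}`, Tonelli's theorem shows
that `ν` is the image of `ν|_A × ds` under the action (`lintegral_invMeasure_polar`).  Integrating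
`ρ^Q` over `{ρ < 1}` gives `ν(A) = Q ω_{α,p} = σ_{α,p}`; integrating `ρ` gives the local
integrability of the flux; and as `Xφ` is the derivative of `φ` along the orbits,
`∫ Xφ dν = -ν(A) φ(0)` (`integral_fderiv_dilationField`), which is the weak equation.
-/

namespace AnisoFinsler

open Filter Topology

variable {m k : ℕ}

/-! ### Minkowski norms and the Legendre correspondence -/

section Minkowski

variable {n : ℕ} {N : EuclideanSpace ℝ (Fin n) → ℝ}

theorem IsMinkowskiNorm.map_zero (hN : IsMinkowskiNorm N) : N 0 = 0 := by
  simpa using hN.homogeneous 0 0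

theorem IsMinkowskiNorm.pos (hN : IsMinkowskiNorm N) {x : EuclideanSpace ℝ (Fin n)}
    (hx : x ≠ 0) : 0 < N x := by
  have hne : x ≠ -x := fun h => by
    have h2 : (2 : ℝ) • x = 0 := by
      rw [two_smul]
      nth_rewrite 1 [h]
      exact neg_add_cancel x
    exact hx ((smul_eq_zero.mp h2).resolve_left two_ne_zero)
  have h := hN.strictConvex_sq.2 (Set.mem_univ x) (Set.mem_univ (-x)) hne
    (half_pos one_pos) (half_pos one_pos) (add_halves 1)
  have hneg : N (-x) = N x := by simpa using hN.homogeneous (-1) x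
  have h0 : (1 / 2 : ℝ) • x + (1 / 2 : ℝ) • -x = 0 := by simp
  simp only [h0, hN.map_zero, hneg, smul_eq_mul] at h
  refine lt_of_le_of_ne (hN.nonneg x) fun h' => ?_
  rw [← h'] at h
  norm_num at h

theorem IsMinkowskiNorm.continuous (hN : IsMinkowskiNorm N) : Continuous N := by
  have h : Continuous fun x => N x ^ 2 :=
    continuousOn_univ.mp (hN.strictConvex_sq.convexOn.continuousOn isOpen_univ)
  have h2 : N = fun x => √(N x ^ 2) := funext fun x => (Real.sqrt_sq (hN.nonneg x)).symm
  rw [h2]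
  exact h.sqrt

/-- A continuous, absolutely homogeneous function which is positive off the origin dominates a
multiple of the Euclidean norm, by compactness of the unit sphere. -/
theorem exists_norm_le_of_homogeneous {f : EuclideanSpace ℝ (Fin n) → ℝ} (hc : Continuous f)
    (hh : ∀ (c : ℝ) x, f (c • x) = |c| * f x) (hpos : ∀ x, x ≠ 0 → 0 < f x) :
    ∃ c, 0 < c ∧ ∀ x, c * ‖x‖ ≤ f x := by
  have h0 : f 0 = 0 := by simpa using hh 0 0
  rcases (Metric.sphere (0 : EuclideanSpace ℝ (Fin n)) 1).eq_empty_or_nonempty with he | hne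
  · refine ⟨1, one_pos, fun x => ?_⟩
    by_cases hx : x = 0
    · simp [hx, h0]
    · have : (‖x‖⁻¹ • x) ∈ Metric.sphere (0 : EuclideanSpace ℝ (Fin n)) 1 := by
        simp [norm_smul, hx]
      rw [he] at this
      exact this.elim
  · obtain ⟨y, hy, hmin⟩ := (isCompact_sphere (0 : EuclideanSpace ℝ (Fin n)) 1).exists_isMinOn
      hne hc.continuousOn
    have hy0 : y ≠ 0 := by
      rintro rfl
      simp at hy
    refine ⟨f y, hpos y hy0, fun x => ?_⟩
    by_cases hx : x = 0
    · simp [hx, h0]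
    · have hmem : (‖x‖⁻¹ • x) ∈ Metric.sphere (0 : EuclideanSpace ℝ (Fin n)) 1 := by
        simp [norm_smul, hx]
      have h1 : f y ≤ f (‖x‖⁻¹ • x) := hmin hmem
      rw [hh, abs_of_nonneg (by positivity)] at h1
      have hxp : 0 < ‖x‖ := norm_pos_iff.mpr hx
      rwa [inv_mul_eq_div, le_div_iff₀ hxp] at h1

theorem IsMinkowskiNorm.exists_maximizer (hN : IsMinkowskiNorm N)
    (x : EuclideanSpace ℝ (Fin n)) :
    ∃ ξ, ∀ ζ, inner ℝ x ζ - N ζ ^ 2 / 2 ≤ inner ℝ x ξ - N ξ ^ 2 / 2 := by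
  obtain ⟨c, hc, hcN⟩ := exists_norm_le_of_homogeneous hN.continuous hN.homogeneous
    fun x hx => hN.pos hx
  have hcont : Continuous fun ζ => N ζ ^ 2 / 2 - inner ℝ x ζ := by
    have := hN.continuous
    fun_prop
  have hlim : Tendsto (fun ζ => N ζ ^ 2 / 2 - inner ℝ x ζ) (cocompact _) atTop := by
    have h1 : Tendsto (fun r : ℝ => r * (c ^ 2 / 2 * r - ‖x‖)) atTop atTop :=
      tendsto_id.atTop_mul_atTop₀
        (tendsto_atTop_add_const_right _ _ (tendsto_id.const_mul_atTop (by positivity)))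
    refine tendsto_atTop_mono (fun ζ => ?_)
      (h1.comp (tendsto_norm_cocompact_atTop (E := EuclideanSpace ℝ (Fin n))))
    have h2 := hcN ζ
    have h3 := real_inner_le_norm x ζ
    have h4 : (c * ‖ζ‖) ^ 2 ≤ N ζ ^ 2 := pow_le_pow_left₀ (by positivity) h2 2
    simp only [Function.comp_apply]
    nlinarith
  obtain ⟨ξ, hξ⟩ := hcont.exists_forall_le hlim
  exact ⟨ξ, fun ζ => by linarith [hξ ζ]⟩

/-- The Legendre map of `N`: the maximizer of `ζ ↦ ⟨x, ζ⟩ - N(ζ)²/2`.  It is the inverse of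
`∇(N²/2)` and the gradient of `(N⁰)²/2`. -/
noncomputable def legendreMap (hN : IsMinkowskiNorm N) (x : EuclideanSpace ℝ (Fin n)) :
    EuclideanSpace ℝ (Fin n) :=
  (hN.exists_maximizer x).choose

theorem IsMinkowskiNorm.le_legendreMap (hN : IsMinkowskiNorm N)
    (x ζ : EuclideanSpace ℝ (Fin n)) :
    inner ℝ x ζ - N ζ ^ 2 / 2 ≤ inner ℝ x (legendreMap hN x) - N (legendreMap hN x) ^ 2 / 2 :=
  (hN.exists_maximizer x).choose_spec ζ

theorem IsMinkowskiNorm.eq_legendreMap (hN : IsMinkowskiNorm N)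
    {x ξ : EuclideanSpace ℝ (Fin n)}
    (h : ∀ ζ, inner ℝ x ζ - N ζ ^ 2 / 2 ≤ inner ℝ x ξ - N ξ ^ 2 / 2) :
    ξ = legendreMap hN x := by
  by_contra hne
  have h1 := hN.strictConvex_sq.2 (Set.mem_univ ξ) (Set.mem_univ (legendreMap hN x)) hne
    (half_pos one_pos) (half_pos one_pos) (add_halves 1)
  have h2 := h ((1 / 2 : ℝ) • ξ + (1 / 2 : ℝ) • legendreMap hN x)
  have h3 := h (legendreMap hN x)
  have h4 := hN.le_legendreMap x ξ
  simp only [smul_eq_mul, inner_add_right, inner_smul_right] at h1 h2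
  linarith

theorem IsMinkowskiNorm.legendreMap_smul (hN : IsMinkowskiNorm N) (c : ℝ)
    (x : EuclideanSpace ℝ (Fin n)) : legendreMap hN (c • x) = c • legendreMap hN x := by
  symm
  apply hN.eq_legendreMap
  intro ζ
  simp only [inner_smul_left, inner_smul_right, hN.homogeneous, mul_pow, sq_abs, conj_trivial]
  by_cases hc : c = 0
  · subst hc
    simp
    positivity
  · have h := hN.le_legendreMap x (c⁻¹ • ζ)
    simp only [inner_smul_right, hN.homogeneous, mul_pow, sq_abs] at h
    have h2 := mul_le_mul_of_nonneg_left h (sq_nonneg c)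
    have h3 : c ^ 2 * (c⁻¹ * inner ℝ x ζ - c⁻¹ ^ 2 * N ζ ^ 2 / 2)
        = c * inner ℝ x ζ - N ζ ^ 2 / 2 := by
      field_simp
    rw [h3] at h2
    linarith

theorem IsMinkowskiNorm.legendreMap_zero (hN : IsMinkowskiNorm N) : legendreMap hN 0 = 0 := by
  simpa using hN.legendreMap_smul 0 0

theorem IsMinkowskiNorm.inner_legendreMap (hN : IsMinkowskiNorm N)
    (x : EuclideanSpace ℝ (Fin n)) :
    inner ℝ x (legendreMap hN x) = N (legendreMap hN x) ^ 2 := by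
  set a := inner ℝ x (legendreMap hN x)
  set b := N (legendreMap hN x) ^ 2
  -- Optimality along the ray through the maximizer.
  have h : ∀ t : ℝ, t * a - t ^ 2 * b / 2 ≤ a - b / 2 := fun t => by
    have := hN.le_legendreMap x (t • legendreMap hN x)
    simpa only [inner_smul_right, hN.homogeneous, mul_pow, sq_abs] using this
  have hb : 0 ≤ b := sq_nonneg _
  rcases hb.eq_or_lt with hb | hb
  · rw [← hb] at h ⊢
    have h0 := h 0
    have h2 := h 2
    linarith
  · have h1 := h (a / b)
    have h2 : a / b * a - (a / b) ^ 2 * b / 2 = a ^ 2 / b / 2 := by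
      field_simp
      ring
    rw [h2, div_div, div_le_iff₀ (by positivity)] at h1
    nlinarith [sq_nonneg (a - b)]

theorem IsMinkowskiNorm.inner_le_mul (hN : IsMinkowskiNorm N)
    (x ζ : EuclideanSpace ℝ (Fin n)) :
    inner ℝ x ζ ≤ N (legendreMap hN x) * N ζ := by
  by_cases hζ : ζ = 0
  · simp [hζ, hN.map_zero]
  have hpos := hN.pos hζ
  have h := hN.le_legendreMap x ((inner ℝ x ζ / N ζ ^ 2) • ζ)
  rw [hN.inner_legendreMap] at h
  simp only [inner_smul_right, hN.homogeneous, mul_pow, sq_abs] at h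
  have h3 : inner ℝ x ζ / N ζ ^ 2 * inner ℝ x ζ - (inner ℝ x ζ / N ζ ^ 2) ^ 2 * N ζ ^ 2 / 2
      = inner ℝ x ζ ^ 2 / N ζ ^ 2 / 2 := by
    field_simp
    ring
  rw [h3] at h
  have h4 : inner ℝ x ζ ^ 2 / N ζ ^ 2 ≤ N (legendreMap hN x) ^ 2 := by linarith
  rw [div_le_iff₀ (by positivity), ← mul_pow] at h4
  exact (le_abs_self _).trans (abs_le_of_sq_le_sq h4 (mul_nonneg (hN.nonneg _) (hN.nonneg _)))

theorem IsMinkowskiNorm.legendreMap_ne_zero (hN : IsMinkowskiNorm N)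
    {x : EuclideanSpace ℝ (Fin n)} (hx : x ≠ 0) : legendreMap hN x ≠ 0 := by
  intro h
  have h1 := hN.inner_le_mul x x
  rw [h, hN.map_zero, zero_mul, real_inner_self_eq_norm_sq] at h1
  have := norm_pos_iff.mpr hx
  nlinarith

theorem IsMinkowskiNorm.dualNorm_eq (hN : IsMinkowskiNorm N) (x : EuclideanSpace ℝ (Fin n)) :
    dualNorm N x = N (legendreMap hN x) := by
  unfold dualNorm
  by_cases hx : x = 0
  · subst hx
    rw [hN.legendreMap_zero, hN.map_zero]
    refine le_antisymm (Real.sSup_le ?_ le_rfl) (Real.sSup_nonneg ?_) <;>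
    · rintro _ ⟨ξ, -, rfl⟩
      simp
  · have hS := hN.pos (hN.legendreMap_ne_zero hx)
    apply IsGreatest.csSup_eq
    constructor
    · refine ⟨(N (legendreMap hN x))⁻¹ • legendreMap hN x, ?_, ?_⟩
      · simp only [Set.mem_ofPred_eq, hN.homogeneous]
        rw [abs_of_pos (by positivity)]
        field_simp
      · simp only [inner_smul_right, hN.inner_legendreMap]
        field_simp
    · rintro _ ⟨ξ, hξ, rfl⟩
      have := hN.inner_le_mul x ξ
      rw [Set.mem_ofPred_eq] at hξ
      simpa [hξ] using this

theorem IsMinkowskiNorm.dualNorm_nonneg (hN : IsMinkowskiNorm N)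
    (x : EuclideanSpace ℝ (Fin n)) : 0 ≤ dualNorm N x := by
  rw [hN.dualNorm_eq]
  exact hN.nonneg _

theorem IsMinkowskiNorm.dualNorm_pos (hN : IsMinkowskiNorm N) {x : EuclideanSpace ℝ (Fin n)}
    (hx : x ≠ 0) : 0 < dualNorm N x := by
  rw [hN.dualNorm_eq]
  exact hN.pos (hN.legendreMap_ne_zero hx)

theorem IsMinkowskiNorm.dualNorm_smul (hN : IsMinkowskiNorm N) (c : ℝ)
    (x : EuclideanSpace ℝ (Fin n)) : dualNorm N (c • x) = |c| * dualNorm N x := by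
  rw [hN.dualNorm_eq, hN.dualNorm_eq, hN.legendreMap_smul, hN.homogeneous]

theorem IsMinkowskiNorm.dualNorm_zero (hN : IsMinkowskiNorm N) : dualNorm N 0 = 0 := by
  simpa using hN.dualNorm_smul 0 0

theorem IsMinkowskiNorm.abs_inner_le (hN : IsMinkowskiNorm N)
    (x ζ : EuclideanSpace ℝ (Fin n)) : |inner ℝ x ζ| ≤ dualNorm N x * N ζ := by
  rw [hN.dualNorm_eq]
  refine abs_le.mpr ⟨?_, hN.inner_le_mul x ζ⟩
  have h := hN.inner_le_mul x (-ζ)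
  have hneg : N (-ζ) = N ζ := by simpa using hN.homogeneous (-1) ζ
  rw [inner_neg_right, hneg] at h
  linarith

/-- The maximizer is unique and stays bounded for `x` in a bounded set, hence depends continuously
on `x`. -/
theorem IsMinkowskiNorm.continuous_legendreMap (hN : IsMinkowskiNorm N) :
    Continuous (legendreMap hN) := by
  obtain ⟨c, hc, hcN⟩ := exists_norm_le_of_homogeneous hN.continuous hN.homogeneous
    fun x hx => hN.pos hx
  have hbd : ∀ x, ‖legendreMap hN x‖ ≤ ‖x‖ / c ^ 2 := fun x => by
    rw [le_div_iff₀ (by positivity)]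
    have h1 := hcN (legendreMap hN x)
    have h2 := real_inner_le_norm x (legendreMap hN x)
    rw [hN.inner_legendreMap] at h2
    have h4 := pow_le_pow_left₀ (by positivity) h1 2
    rcases (norm_nonneg (legendreMap hN x)).eq_or_lt with h | h
    · rw [← h]
      simp
    · refine le_of_mul_le_mul_right ?_ h
      nlinarith
  refine continuous_iff_continuousAt.mpr fun x => ?_
  refine (isCompact_closedBall (0 : EuclideanSpace ℝ (Fin n)) ((‖x‖ + 1) / c ^ 2)
    ).tendsto_nhds_of_unique_mapClusterPt ?_ ?_
  · have hx : ∀ᶠ y in 𝓝 x, ‖y‖ < ‖x‖ + 1 :=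
      continuous_norm.continuousAt.eventually_lt continuousAt_const (by simp)
    filter_upwards [hx] with y hy
    rw [mem_closedBall_zero_iff]
    exact (hbd y).trans (by gcongr)
  · intro ξ _ hξ
    refine hN.eq_legendreMap fun ζ => ?_
    by_contra! hlt
    -- The strict inequality would persist near `(x, ξ)`, against maximality.
    have hcont : Continuous fun q : EuclideanSpace ℝ (Fin n) × EuclideanSpace ℝ (Fin n) =>
        inner ℝ q.1 q.2 - N q.2 ^ 2 / 2 - (inner ℝ q.1 ζ - N ζ ^ 2 / 2) := by
      have := hN.continuous
      fun_prop
    have hev : ∀ᶠ q in 𝓝 (x, ξ),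
        inner ℝ q.1 q.2 - N q.2 ^ 2 / 2 - (inner ℝ q.1 ζ - N ζ ^ 2 / 2) < 0 :=
      hcont.continuousAt.eventually_lt continuousAt_const (by simpa using hlt)
    rw [nhds_prod_eq, eventually_prod_iff] at hev
    obtain ⟨pa, ha, pb, hb, hab⟩ := hev
    obtain ⟨y, hy1, hy2⟩ := ((hξ.frequently hb).and_eventually ha).exists
    have := hab hy2 hy1
    have h2 := hN.le_legendreMap y ζ
    simp only at this
    linarith

theorem IsMinkowskiNorm.continuous_dualNorm (hN : IsMinkowskiNorm N) :
    Continuous (dualNorm N) := by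
  rw [funext hN.dualNorm_eq]
  exact hN.continuous.comp hN.continuous_legendreMap

/-- The square of the dual norm is differentiable: its half is the convex conjugate of `N²/2`, whose
subgradients at `x` and at `y` trap the increment between `⟨y - x, S x⟩` and `⟨y - x, S y⟩`. -/
theorem IsMinkowskiNorm.hasFDerivAt_dualNorm_sq (hN : IsMinkowskiNorm N)
    (x : EuclideanSpace ℝ (Fin n)) :
    HasFDerivAt (fun y => dualNorm N y ^ 2) ((2 : ℝ) • innerSL ℝ (legendreMap hN x)) x := by
  have key : ∀ a b, inner ℝ (b - a) (legendreMap hN a) ≤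
      dualNorm N b ^ 2 / 2 - dualNorm N a ^ 2 / 2 := fun a b => by
    have h1 := hN.le_legendreMap b (legendreMap hN a)
    have h2 := hN.inner_legendreMap a
    have h3 := hN.inner_legendreMap b
    rw [hN.dualNorm_eq, hN.dualNorm_eq, inner_sub_left]
    linarith
  refine .of_isLittleO ?_
  rw [Asymptotics.isLittleO_iff]
  intro ε hε
  have hS : ∀ᶠ y in 𝓝 x, ‖legendreMap hN y - legendreMap hN x‖ < ε / 2 := by
    have hc : Continuous fun y => ‖legendreMap hN y - legendreMap hN x‖ :=
      (hN.continuous_legendreMap.sub continuous_const).norm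
    exact hc.continuousAt.eventually_lt continuousAt_const (by simpa using hε)
  filter_upwards [hS] with y hy
  have h1 := key x y
  have h2 := key y x
  have h3 := real_inner_le_norm (y - x) (legendreMap hN y - legendreMap hN x)
  rw [inner_sub_right] at h3
  have h4 : ‖y - x‖ * ‖legendreMap hN y - legendreMap hN x‖ ≤ ‖y - x‖ * (ε / 2) := by gcongr
  have h5 : inner ℝ (x - y) (legendreMap hN y) = - inner ℝ (y - x) (legendreMap hN y) := by
    rw [← inner_neg_left, neg_sub]
  have h6 : ((2 : ℝ) • innerSL ℝ (legendreMap hN x)) (y - x)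
      = 2 * inner ℝ (y - x) (legendreMap hN x) := by
    simp [real_inner_comm]
  rw [h6, Real.norm_eq_abs, abs_le]
  constructor <;> nlinarith [norm_nonneg (y - x)]

theorem IsMinkowskiNorm.contDiff_dualNorm_sq (hN : IsMinkowskiNorm N) :
    ContDiff ℝ 1 fun y => dualNorm N y ^ 2 := by
  rw [contDiff_one_iff_fderiv]
  refine ⟨fun x => (hN.hasFDerivAt_dualNorm_sq x).differentiableAt, ?_⟩
  rw [funext fun x => (hN.hasFDerivAt_dualNorm_sq x).fderiv]
  have := hN.continuous_legendreMap
  fun_prop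

/-- The Legendre map inverts `N ∇N = ∇(N²/2)`: this is the first-order condition for the
maximizer. -/
theorem IsMinkowskiNorm.smul_gradient_legendreMap (hN : IsMinkowskiNorm N)
    (x : EuclideanSpace ℝ (Fin n)) :
    N (legendreMap hN x) • gradient N (legendreMap hN x) = x := by
  by_cases hx : x = 0
  · subst hx
    rw [hN.legendreMap_zero, hN.map_zero, zero_smul]
  have hS := hN.legendreMap_ne_zero hx
  have hsq : DifferentiableAt ℝ (fun y => N y ^ 2) (legendreMap hN x) :=
    (hN.contDiffOn_sq.differentiableOn (by norm_num)).differentiableAt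
      (isOpen_compl_singleton.mem_nhds hS)
  have hd : DifferentiableAt ℝ N (legendreMap hN x) := by
    have h2 : N = fun x => √(N x ^ 2) := funext fun x => (Real.sqrt_sq (hN.nonneg x)).symm
    have h3 := hsq.sqrt (pow_pos (hN.pos hS) 2).ne'
    rwa [← h2] at h3
  have hG := hd.hasGradientAt.hasFDerivAt
  have hF : HasFDerivAt (fun ζ => (1 / 2 : ℝ) * N ζ ^ 2 - innerSL ℝ x ζ) _ (legendreMap hN x) :=
    ((hG.pow 2).const_mul (1 / 2 : ℝ)).sub (innerSL ℝ x).hasFDerivAt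
  have hmin : IsLocalMin (fun ζ => (1 / 2 : ℝ) * N ζ ^ 2 - innerSL ℝ x ζ) (legendreMap hN x) :=
    Eventually.of_forall fun ζ => by
      have := hN.le_legendreMap x ζ
      simp only [innerSL_apply_apply]
      linarith
  have h0 := hmin.hasFDerivAt_eq_zero hF
  refine ext_inner_right ℝ fun v => ?_
  have := congrArg (fun L => L v) h0
  simp only [sub_apply, smul_apply,
    InnerProductSpace.toDual_apply_apply, innerSL_apply_apply, smul_eq_mul,
    zero_apply, nsmul_eq_mul, Nat.cast_ofNat, pow_one,
    Nat.add_one_sub_one] at this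
  rw [real_inner_smul_left]
  linarith

end Minkowski

/-! ### The dual gauge -/

section DualGauge

variable {Φ : EuclideanSpace ℝ (Fin m) → ℝ} {Ψ : EuclideanSpace ℝ (Fin k) → ℝ} {α : ℝ}

/-- The power `ρ^{2(α+1)} = Φ⁰(z)^{2(α+1)} + 4(α+1)² Ψ⁰(σ)²` of the dual gauge, which is `C¹` on the
whole space. -/
noncomputable def dualGaugePow (α : ℝ) (Φ : EuclideanSpace ℝ (Fin m) → ℝ)
    (Ψ : EuclideanSpace ℝ (Fin k) → ℝ) (x : Space m k) : ℝ :=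
  dualNorm Φ x.1 ^ (2 * (α + 1)) + 4 * (α + 1) ^ 2 * dualNorm Ψ x.2 ^ 2

theorem rpow_two_mul_eq_sq {a : ℝ} (ha : 0 ≤ a) (b : ℝ) : a ^ (2 * b) = (a ^ b) ^ 2 := by
  rw [mul_comm, Real.rpow_mul ha, Real.rpow_two]

theorem dualGaugePow_nonneg (hΦ : IsMinkowskiNorm Φ) (x : Space m k) :
    0 ≤ dualGaugePow α Φ Ψ x := by
  have := hΦ.dualNorm_nonneg x.1
  unfold dualGaugePow
  positivity

/-- The supremum defining `ρ` splits: writing `Θ(ξ, τ) = 1` as `A² + B² = 1` with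
`A = Φ(ξ)^{α+1}` and `B = 2(α+1)Ψ(τ)`, it is the Cauchy–Schwarz maximum of
`Φ⁰(z)^{α+1} A + 2(α+1)Ψ⁰(σ) B`. -/
theorem dualGauge_eq (hΦ : IsMinkowskiNorm Φ) (hΨ : IsMinkowskiNorm Ψ) (hα : 0 < α)
    (x : Space m k) :
    dualGauge α Φ Ψ x = dualGaugePow α Φ Ψ x ^ (1 / (2 * (α + 1))) := by
  obtain ⟨z, σ⟩ := x
  have hα1 : 0 < α + 1 := by linarith
  have hz := hΦ.dualNorm_nonneg z
  have hσ := hΨ.dualNorm_nonneg σ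
  set a := dualNorm Φ z ^ (α + 1) with ha
  set b := 2 * (α + 1) * dualNorm Ψ σ with hb
  have ha0 : 0 ≤ a := by positivity
  have hb0 : 0 ≤ b := by positivity
  have hP : dualGaugePow α Φ Ψ (z, σ) = a ^ 2 + b ^ 2 := by
    simp only [dualGaugePow, rpow_two_mul_eq_sq hz, ha, hb]
    ring
  have hgauge : ∀ y : Space m k, gauge α Φ Ψ y = 1 →
      (Φ y.1 ^ (α + 1)) ^ 2 + (2 * (α + 1) * Ψ y.2) ^ 2 = 1 := fun y hy => by
    have h0 := hΦ.nonneg y.1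
    unfold gauge at hy
    rw [rpow_two_mul_eq_sq h0] at hy
    have h1 : 0 ≤ (Φ y.1 ^ (α + 1)) ^ 2 + 4 * (α + 1) ^ 2 * Ψ y.2 ^ 2 := by positivity
    have h2 := Real.rpow_rpow_inv h1 (y := 1 / (2 * (α + 1))) (by positivity)
    rw [hy, Real.one_rpow] at h2
    linear_combination -h2
  have hupper : ∀ y : Space m k, gauge α Φ Ψ y = 1 →
      |inner ℝ z y.1| ^ (α + 1) + 4 * (α + 1) ^ 2 * inner ℝ σ y.2 ≤ √(a ^ 2 + b ^ 2) := by
    intro y hy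
    have h1 := hgauge y hy
    have h2 : |inner ℝ z y.1| ^ (α + 1) ≤ a * Φ y.1 ^ (α + 1) := by
      rw [ha, ← Real.mul_rpow hz (hΦ.nonneg _)]
      exact Real.rpow_le_rpow (abs_nonneg _) (hΦ.abs_inner_le _ _) hα1.le
    have h3 : 4 * (α + 1) ^ 2 * inner ℝ σ y.2 ≤ b * (2 * (α + 1) * Ψ y.2) := by
      have := (le_abs_self _).trans (hΨ.abs_inner_le σ y.2)
      have h4 := mul_le_mul_of_nonneg_left this (by positivity : 0 ≤ 4 * (α + 1) ^ 2)
      rw [hb]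
      linarith
    set A := Φ y.1 ^ (α + 1)
    set B := 2 * (α + 1) * Ψ y.2
    have h5 : (a * A + b * B) ^ 2 ≤ a ^ 2 + b ^ 2 := by
      have h6 : (a * A + b * B) ^ 2 = (a ^ 2 + b ^ 2) * (A ^ 2 + B ^ 2) - (a * B - b * A) ^ 2 := by
        ring
      rw [h6, h1]
      linarith [sq_nonneg (a * B - b * A)]
    exact (add_le_add h2 h3).trans (Real.le_sqrt_of_sq_le h5)
  have hsup : sSup ((fun y : Space m k =>
      |inner ℝ z y.1| ^ (α + 1) + 4 * (α + 1) ^ 2 * inner ℝ σ y.2) ''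
      {y | gauge α Φ Ψ y = 1}) = √(a ^ 2 + b ^ 2) := by
    rcases (Real.sqrt_nonneg (a ^ 2 + b ^ 2)).eq_or_lt with h0 | hR
    · have hab : a ^ 2 + b ^ 2 = 0 := by
        rw [eq_comm, Real.sqrt_eq_zero (by positivity)] at h0
        exact h0
      have hz0 : z = 0 := by
        by_contra hne
        have : 0 < a := Real.rpow_pos_of_pos (hΦ.dualNorm_pos hne) _
        nlinarith [sq_nonneg b, pow_pos this 2]
      have hσ0 : σ = 0 := by
        by_contra hne
        have : 0 < b := mul_pos (by positivity) (hΨ.dualNorm_pos hne)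
        nlinarith [sq_nonneg a, pow_pos this 2]
      rw [← h0, hz0, hσ0]
      refine le_antisymm (Real.sSup_le ?_ le_rfl) (Real.sSup_nonneg ?_) <;>
      · rintro _ ⟨ξ, -, rfl⟩
        simp [Real.zero_rpow hα1.ne']
    · apply IsGreatest.csSup_eq
      refine ⟨?_, ?_⟩
      · set R := √(a ^ 2 + b ^ 2) with hRdef
        have hR2 : R ^ 2 = a ^ 2 + b ^ 2 := Real.sq_sqrt (by positivity)
        have hc : 0 ≤ R⁻¹ ^ (α + 1)⁻¹ := by positivity
        have hc1 : (R⁻¹ ^ (α + 1)⁻¹) ^ (α + 1) = R⁻¹ :=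
          Real.rpow_inv_rpow (by positivity) hα1.ne'
        refine ⟨(R⁻¹ ^ (α + 1)⁻¹ • legendreMap hΦ z, R⁻¹ • legendreMap hΨ σ), ?_, ?_⟩
        · have h1 : (R⁻¹ * a) ^ 2 + 4 * (α + 1) ^ 2 * (R⁻¹ * dualNorm Ψ σ) ^ 2 = 1 := by
            have : (R⁻¹ * a) ^ 2 + 4 * (α + 1) ^ 2 * (R⁻¹ * dualNorm Ψ σ) ^ 2
              = (R⁻¹) ^ 2 * (a ^ 2 + b ^ 2) := by rw [hb]; ring
            rw [this, ← hR2]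
            field_simp
          simp only [Set.mem_ofPred_eq, gauge, hΦ.homogeneous, hΨ.homogeneous,
            ← hΦ.dualNorm_eq, ← hΨ.dualNorm_eq, abs_of_nonneg hc,
            abs_of_pos (inv_pos.mpr hR)]
          rw [rpow_two_mul_eq_sq (by positivity), Real.mul_rpow hc hz, hc1, h1, Real.one_rpow]
        · simp only [inner_smul_right, hΦ.inner_legendreMap, hΨ.inner_legendreMap,
            ← hΦ.dualNorm_eq, ← hΨ.dualNorm_eq]
          rw [abs_of_nonneg (by positivity), Real.mul_rpow hc (by positivity), hc1,
            ← Real.rpow_natCast_mul hz, mul_comm ((2 : ℕ) : ℝ), Real.rpow_mul_natCast hz, ← ha]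
          have : R⁻¹ * a ^ 2 + 4 * (α + 1) ^ 2 * (R⁻¹ * dualNorm Ψ σ ^ 2)
              = R⁻¹ * (a ^ 2 + b ^ 2) := by rw [hb]; ring
          rw [this, ← hR2]
          field_simp
      · rintro _ ⟨y, hy, rfl⟩
        exact hupper y hy
  unfold dualGauge
  simp only
  rw [hsup, hP, Real.sqrt_eq_rpow, ← Real.rpow_mul (by positivity)]
  congr 1
  field_simp

theorem dualGauge_nonneg (hΦ : IsMinkowskiNorm Φ) (hΨ : IsMinkowskiNorm Ψ) (hα : 0 < α)
    (x : Space m k) : 0 ≤ dualGauge α Φ Ψ x := by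
  rw [dualGauge_eq hΦ hΨ hα]
  exact Real.rpow_nonneg (dualGaugePow_nonneg hΦ x) _

theorem dualGaugePow_pos (hΦ : IsMinkowskiNorm Φ) (hΨ : IsMinkowskiNorm Ψ) (hα : 0 < α)
    {x : Space m k} (hx : x ≠ 0) : 0 < dualGaugePow α Φ Ψ x := by
  have h1 := hΦ.dualNorm_nonneg x.1
  unfold dualGaugePow
  by_cases hz : x.1 = 0
  · have hσ : x.2 ≠ 0 := fun h => hx (Prod.ext hz h)
    have := hΨ.dualNorm_pos hσ
    positivity
  · have := hΦ.dualNorm_pos hz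
    positivity

theorem dualGauge_pos (hΦ : IsMinkowskiNorm Φ) (hΨ : IsMinkowskiNorm Ψ) (hα : 0 < α)
    {x : Space m k} (hx : x ≠ 0) : 0 < dualGauge α Φ Ψ x := by
  rw [dualGauge_eq hΦ hΨ hα]
  exact Real.rpow_pos_of_pos (dualGaugePow_pos hΦ hΨ hα hx) _

theorem dualGauge_zero (hΦ : IsMinkowskiNorm Φ) (hΨ : IsMinkowskiNorm Ψ) (hα : 0 < α) :
    dualGauge α Φ Ψ (0 : Space m k) = 0 := by
  have hα1 : 0 < α + 1 := by linarith
  rw [dualGauge_eq hΦ hΨ hα, dualGaugePow]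
  simp only [Prod.fst_zero, Prod.snd_zero, hΦ.dualNorm_zero, hΨ.dualNorm_zero]
  rw [Real.zero_rpow (by positivity), zero_pow two_ne_zero, mul_zero, add_zero,
    Real.zero_rpow (by positivity)]

theorem dualGauge_rpow (hΦ : IsMinkowskiNorm Φ) (hΨ : IsMinkowskiNorm Ψ) (hα : 0 < α)
    (x : Space m k) : dualGauge α Φ Ψ x ^ (2 * (α + 1)) = dualGaugePow α Φ Ψ x := by
  have hα1 : 0 < α + 1 := by linarith
  rw [dualGauge_eq hΦ hΨ hα, one_div,
    Real.rpow_inv_rpow (dualGaugePow_nonneg hΦ x) (by positivity)]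

theorem continuous_dualGaugePow (hΦ : IsMinkowskiNorm Φ) (hΨ : IsMinkowskiNorm Ψ) (hα : 0 < α) :
    Continuous (dualGaugePow α Φ Ψ) := by
  have h1 := hΦ.continuous_dualNorm
  have h2 := hΨ.continuous_dualNorm
  have h3 : Continuous fun x : Space m k => dualNorm Φ x.1 ^ (2 * (α + 1)) :=
    (h1.comp continuous_fst).rpow_const fun x => Or.inr (by linarith)
  unfold dualGaugePow
  fun_prop

theorem continuous_dualGauge (hΦ : IsMinkowskiNorm Φ) (hΨ : IsMinkowskiNorm Ψ) (hα : 0 < α) :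
    Continuous (dualGauge α Φ Ψ) := by
  rw [funext (dualGauge_eq hΦ hΨ hα)]
  exact (continuous_dualGaugePow hΦ hΨ hα).rpow_const fun x => Or.inr (by positivity)

theorem dualNorm_fst_le_dualGauge (hΦ : IsMinkowskiNorm Φ) (hΨ : IsMinkowskiNorm Ψ) (hα : 0 < α)
    (x : Space m k) : dualNorm Φ x.1 ≤ dualGauge α Φ Ψ x := by
  have hα1 : 0 < 2 * (α + 1) := by linarith
  refine (Real.rpow_le_rpow_iff (hΦ.dualNorm_nonneg _) (dualGauge_nonneg hΦ hΨ hα x) hα1).mp ?_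
  rw [dualGauge_rpow hΦ hΨ hα, dualGaugePow]
  have : 0 ≤ 4 * (α + 1) ^ 2 * dualNorm Ψ x.2 ^ 2 := by positivity
  linarith

theorem dualNorm_snd_le_dualGauge (hΦ : IsMinkowskiNorm Φ) (hΨ : IsMinkowskiNorm Ψ) (hα : 0 < α)
    (x : Space m k) : dualNorm Ψ x.2 ≤ dualGauge α Φ Ψ x ^ (α + 1) := by
  have h1 := dualGauge_rpow hΦ hΨ hα x
  have h2 := dualGauge_nonneg hΦ hΨ hα x
  rw [rpow_two_mul_eq_sq h2, dualGaugePow] at h1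
  have h3 := hΦ.dualNorm_nonneg x.1
  have h4 : 0 ≤ dualNorm Φ x.1 ^ (2 * (α + 1)) := by positivity
  refine (le_abs_self _).trans (abs_le_of_sq_le_sq ?_ (by positivity))
  rw [h1]
  have : 1 * dualNorm Ψ x.2 ^ 2 ≤ 4 * (α + 1) ^ 2 * dualNorm Ψ x.2 ^ 2 := by
    gcongr
    nlinarith
  linarith

end DualGauge

/-! ### Dilations -/

section Dilation

variable {Φ : EuclideanSpace ℝ (Fin m) → ℝ} {Ψ : EuclideanSpace ℝ (Fin k) → ℝ} {α : ℝ}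

/-- The one-parameter group of anisotropic dilations `(z, σ) ↦ (eˢ z, e^{(α+1)s} σ)`, written in
the additive parameter `s`. -/
noncomputable def dilation (α s : ℝ) (x : Space m k) : Space m k :=
  (Real.exp s • x.1, Real.exp ((α + 1) * s) • x.2)

/-- The infinitesimal generator `(z, (α+1) σ)` of the dilations. -/
def dilationField (α : ℝ) (x : Space m k) : Space m k := (x.1, (α + 1) • x.2)

theorem dilation_neg_dilation (s : ℝ) (x : Space m k) :
    dilation α (-s) (dilation α s x) = x := by
  simp [dilation, smul_smul, ← Real.exp_add]

theorem continuous_dilation :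
    Continuous fun q : ℝ × Space m k => dilation α q.1 q.2 := by
  unfold dilation
  fun_prop

theorem hasDerivAt_dilation (x : Space m k) (s : ℝ) :
    HasDerivAt (fun s => dilation α s x) (dilationField α (dilation α s x)) s := by
  have h1 : HasDerivAt (fun s => Real.exp s • x.1) (Real.exp s • x.1) s :=
    (Real.hasDerivAt_exp s).smul_const x.1
  have h2 : HasDerivAt (fun s => Real.exp ((α + 1) * s) • x.2)
      ((α + 1) • Real.exp ((α + 1) * s) • x.2) s := by
    have := (((hasDerivAt_id s).const_mul (α + 1)).exp).smul_const x.2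
    simp only [mul_one, id] at this
    rwa [smul_smul, mul_comm (α + 1)]
  exact h1.prodMk h2

theorem dualGauge_dilation (hΦ : IsMinkowskiNorm Φ) (hΨ : IsMinkowskiNorm Ψ) (hα : 0 < α)
    (s : ℝ) (x : Space m k) :
    dualGauge α Φ Ψ (dilation α s x) = Real.exp s * dualGauge α Φ Ψ x := by
  have hα1 : 0 < α + 1 := by linarith
  have h0 := hΦ.dualNorm_nonneg x.1
  have hP : dualGaugePow α Φ Ψ (dilation α s x)
      = Real.exp (2 * (α + 1) * s) * dualGaugePow α Φ Ψ x := by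
    simp only [dualGaugePow, dilation, hΦ.dualNorm_smul, hΨ.dualNorm_smul, Real.abs_exp]
    have h1 : s * (2 * (α + 1)) = 2 * (α + 1) * s := by ring
    have h2 : ((2 : ℕ) : ℝ) * ((α + 1) * s) = 2 * (α + 1) * s := by
      push_cast
      ring
    rw [Real.mul_rpow (Real.exp_pos _).le h0, ← Real.exp_mul, mul_pow, ← Real.exp_nat_mul, h1, h2]
    ring
  rw [dualGauge_eq hΦ hΨ hα, dualGauge_eq hΦ hΨ hα, hP,
    Real.mul_rpow (Real.exp_pos _).le (dualGaugePow_nonneg hΦ x), ← Real.exp_mul]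
  congr 2
  field_simp

theorem weight_dilation (hΦ : IsMinkowskiNorm Φ) (hΨ : IsMinkowskiNorm Ψ) (hα : 0 < α)
    (p s : ℝ) (x : Space m k) :
    weight α p Φ Ψ (dilation α s x) = weight α p Φ Ψ x := by
  have h : dualNorm Φ (dilation α s x).1 = Real.exp s * dualNorm Φ x.1 := by
    simp [dilation, hΦ.dualNorm_smul]
  rw [weight, weight, dualGauge_dilation hΦ hΨ hα, h, mul_div_mul_left _ _ (Real.exp_pos s).ne']

theorem dilation_tendsto_zero (hα : 0 < α) (x : Space m k) :
    Tendsto (fun s => dilation α s x) atBot (𝓝 0) := by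
  have h1 : Tendsto (fun s => Real.exp s • x.1) atBot (𝓝 0) := by
    simpa using Real.tendsto_exp_atBot.smul_const x.1
  have h2 : Tendsto (fun s => Real.exp ((α + 1) * s) • x.2) atBot (𝓝 0) := by
    have : Tendsto (fun s => (α + 1) * s) atBot atBot :=
      tendsto_id.const_mul_atBot (by linarith)
    simpa using (Real.tendsto_exp_atBot.comp this).smul_const x.2
  exact h1.prodMk_nhds h2

/-- The dilations multiply Lebesgue measure by a power of the scale whose exponent is the
homogeneous dimension. -/
theorem lintegral_comp_dilation (s : ℝ) (f : Space m k → ENNReal) (hf : Measurable f) :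
    ∫⁻ x, f (dilation α s x) = ENNReal.ofReal (Real.exp (-(homDim m k α * s))) * ∫⁻ x, f x := by
  have h1 := Measure.map_addHaar_smul (volume : Measure (EuclideanSpace ℝ (Fin m)))
    (Real.exp_pos s).ne'
  have h2 := Measure.map_addHaar_smul (volume : Measure (EuclideanSpace ℝ (Fin k)))
    (Real.exp_pos ((α + 1) * s)).ne'
  have hmap : (volume : Measure (Space m k)).map (dilation α s)
      = ENNReal.ofReal (Real.exp (-(homDim m k α * s))) • volume := by
    rw [Measure.volume_eq_prod]
    have : (dilation α s : Space m k → Space m k) = Prod.map (fun z => Real.exp s • z)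
      (fun σ => Real.exp ((α + 1) * s) • σ) := rfl
    rw [this, ← Measure.map_prod_map _ _ (by fun_prop) (by fun_prop), h1, h2,
      Measure.prod_smul_left, Measure.prod_smul_right, smul_smul,
      ← ENNReal.ofReal_mul (abs_nonneg _), finrank_euclideanSpace_fin, finrank_euclideanSpace_fin,
      abs_of_pos (by positivity), abs_of_pos (by positivity), ← Real.exp_nat_mul,
      ← Real.exp_nat_mul, ← Real.exp_neg, ← Real.exp_neg, ← Real.exp_add]
    congr 3
    unfold homDim
    ring
  have hm : Measurable (dilation α s : Space m k → Space m k) := by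
    have : Continuous (dilation α s : Space m k → Space m k) := by
      unfold dilation
      fun_prop
    exact this.measurable
  rw [← lintegral_map hf hm, hmap, lintegral_smul_measure, smul_eq_mul]

end Dilation

/-! ### Polar decomposition of the dilation-invariant measure -/

section Polar

variable {Φ : EuclideanSpace ℝ (Fin m) → ℝ} {Ψ : EuclideanSpace ℝ (Fin k) → ℝ} {α p : ℝ}

/-- The density `(Φ⁰(z)/ρ)^{αp} ρ^{-Q}`, homogeneous of degree `-Q` under the dilations. -/
noncomputable def invDensity (α p : ℝ) (Φ : EuclideanSpace ℝ (Fin m) → ℝ)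
    (Ψ : EuclideanSpace ℝ (Fin k) → ℝ) (x : Space m k) : ℝ :=
  weight α p Φ Ψ x * dualGauge α Φ Ψ x ^ (-homDim m k α)

/-- The measure with density `(Φ⁰(z)/ρ)^{αp} ρ^{-Q}`, which is invariant under the dilations. -/
noncomputable def invMeasure (α p : ℝ) (Φ : EuclideanSpace ℝ (Fin m) → ℝ)
    (Ψ : EuclideanSpace ℝ (Fin k) → ℝ) : Measure (Space m k) :=
  volume.withDensity fun x => ENNReal.ofReal (invDensity α p Φ Ψ x)

instance : SFinite (invMeasure (m := m) (k := k) α p Φ Ψ) := by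
  unfold invMeasure
  infer_instance

/-- The annulus `{1 ≤ ρ < e}`, a fundamental domain for integer steps of the dilation group. -/
def annulus (α : ℝ) (Φ : EuclideanSpace ℝ (Fin m) → ℝ) (Ψ : EuclideanSpace ℝ (Fin k) → ℝ) :
    Set (Space m k) :=
  {x | 1 ≤ dualGauge α Φ Ψ x ∧ dualGauge α Φ Ψ x < Real.exp 1}

theorem weight_nonneg (hΦ : IsMinkowskiNorm Φ) (hΨ : IsMinkowskiNorm Ψ) (hα : 0 < α)
    (x : Space m k) : 0 ≤ weight α p Φ Ψ x :=
  Real.rpow_nonneg (div_nonneg (hΦ.dualNorm_nonneg _) (dualGauge_nonneg hΦ hΨ hα x)) _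

theorem weight_le_one (hΦ : IsMinkowskiNorm Φ) (hΨ : IsMinkowskiNorm Ψ) (hα : 0 < α)
    (hp : 0 < p) (x : Space m k) : weight α p Φ Ψ x ≤ 1 :=
  Real.rpow_le_one (div_nonneg (hΦ.dualNorm_nonneg _) (dualGauge_nonneg hΦ hΨ hα x))
    (div_le_one_of_le₀ (dualNorm_fst_le_dualGauge hΦ hΨ hα x) (dualGauge_nonneg hΦ hΨ hα x))
    (by positivity)

theorem weight_pos (hΦ : IsMinkowskiNorm Φ) (hΨ : IsMinkowskiNorm Ψ) (hα : 0 < α)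
    {x : Space m k} (hx : x.1 ≠ 0) : 0 < weight α p Φ Ψ x :=
  Real.rpow_pos_of_pos (div_pos (hΦ.dualNorm_pos hx)
    (dualGauge_pos hΦ hΨ hα fun h => hx (by rw [h]; rfl))) _

theorem weight_zero (hΦ : IsMinkowskiNorm Φ) (hα : 0 < α) (hp : 0 < p) :
    weight α p Φ Ψ (0 : Space m k) = 0 := by
  rw [weight, Prod.fst_zero, hΦ.dualNorm_zero, zero_div, Real.zero_rpow (by positivity)]

theorem measurable_weight (hΦ : IsMinkowskiNorm Φ) (hΨ : IsMinkowskiNorm Ψ) (hα : 0 < α) :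
    Measurable (weight α p Φ Ψ) :=
  ((hΦ.continuous_dualNorm.measurable.comp measurable_fst).div
    (continuous_dualGauge hΦ hΨ hα).measurable).pow_const _

theorem invDensity_nonneg (hΦ : IsMinkowskiNorm Φ) (hΨ : IsMinkowskiNorm Ψ) (hα : 0 < α)
    (x : Space m k) : 0 ≤ invDensity α p Φ Ψ x :=
  mul_nonneg (weight_nonneg hΦ hΨ hα x) (Real.rpow_nonneg (dualGauge_nonneg hΦ hΨ hα x) _)

theorem measurable_invDensity (hΦ : IsMinkowskiNorm Φ) (hΨ : IsMinkowskiNorm Ψ) (hα : 0 < α) :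
    Measurable (invDensity α p Φ Ψ) :=
  (measurable_weight hΦ hΨ hα).mul ((continuous_dualGauge hΦ hΨ hα).measurable.pow_const _)

theorem measurable_dilation (s : ℝ) :
    Measurable (dilation α s : Space m k → Space m k) := by
  have h := (continuous_dilation (α := α) (m := m) (k := k)).comp
    (continuous_const.prodMk continuous_id : Continuous fun x : Space m k => (s, x))
  exact h.measurable

theorem lintegral_invMeasure (hΦ : IsMinkowskiNorm Φ) (hΨ : IsMinkowskiNorm Ψ) (hα : 0 < α)
    {f : Space m k → ENNReal} (hf : Measurable f) :
    ∫⁻ x, f x ∂invMeasure α p Φ Ψ = ∫⁻ x, ENNReal.ofReal (invDensity α p Φ Ψ x) * f x :=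
  lintegral_withDensity_eq_lintegral_mul _ (measurable_invDensity hΦ hΨ hα).ennreal_ofReal hf

theorem lintegral_invMeasure_dilation (hΦ : IsMinkowskiNorm Φ) (hΨ : IsMinkowskiNorm Ψ)
    (hα : 0 < α) (s : ℝ) {f : Space m k → ENNReal} (hf : Measurable f) :
    ∫⁻ x, f (dilation α s x) ∂invMeasure α p Φ Ψ = ∫⁻ x, f x ∂invMeasure α p Φ Ψ := by
  have hd := (measurable_invDensity (p := p) hΦ hΨ hα).ennreal_ofReal
  have h0 := lintegral_invMeasure (p := p) hΦ hΨ hα (hf.comp (measurable_dilation (α := α) s))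
  simp only [Function.comp_apply] at h0
  rw [h0, lintegral_invMeasure hΦ hΨ hα hf]
  have h : ∀ x : Space m k, ENNReal.ofReal (invDensity α p Φ Ψ x) * f (dilation α s x)
      = ENNReal.ofReal (Real.exp (homDim m k α * s)) *
        (ENNReal.ofReal (invDensity α p Φ Ψ (dilation α s x)) * f (dilation α s x)) := fun x => by
    rw [← mul_assoc, ← ENNReal.ofReal_mul (Real.exp_pos _).le]
    congr 2
    rw [invDensity, invDensity, weight_dilation hΦ hΨ hα, dualGauge_dilation hΦ hΨ hα,
      Real.mul_rpow (Real.exp_pos _).le (dualGauge_nonneg hΦ hΨ hα x), ← Real.exp_mul]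
    have : Real.exp (homDim m k α * s) * Real.exp (s * -homDim m k α) = 1 := by
      rw [← Real.exp_add, mul_comm s]
      simp
    linear_combination (-(weight α p Φ Ψ x * dualGauge α Φ Ψ x ^ (-homDim m k α))) * this
  simp_rw [h]
  rw [lintegral_const_mul' _ _ ENNReal.ofReal_ne_top,
    lintegral_comp_dilation s (fun x => ENNReal.ofReal (invDensity α p Φ Ψ x) * f x) (hd.mul hf),
    ← mul_assoc, ← ENNReal.ofReal_mul (Real.exp_pos _).le, ← Real.exp_add]
  simp

theorem measurableSet_annulus (hΦ : IsMinkowskiNorm Φ) (hΨ : IsMinkowskiNorm Ψ) (hα : 0 < α) :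
    MeasurableSet (annulus α Φ Ψ) :=
  (measurableSet_le measurable_const (continuous_dualGauge hΦ hΨ hα).measurable).inter
    (measurableSet_lt (continuous_dualGauge hΦ hΨ hα).measurable measurable_const)

theorem ne_zero_of_mem_annulus (hΦ : IsMinkowskiNorm Φ) (hΨ : IsMinkowskiNorm Ψ) (hα : 0 < α)
    {x : Space m k} (hx : x ∈ annulus α Φ Ψ) : x ≠ 0 := by
  rintro rfl
  have := hx.1
  rw [dualGauge_zero hΦ hΨ hα] at this
  linarith

theorem ae_invMeasure_ne_zero (hΦ : IsMinkowskiNorm Φ) (hΨ : IsMinkowskiNorm Ψ) (hα : 0 < α)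
    (hp : 0 < p) : ∀ᵐ x ∂invMeasure (m := m) (k := k) α p Φ Ψ, x ≠ 0 := by
  rw [invMeasure, ae_withDensity_iff (measurable_invDensity hΦ hΨ hα).ennreal_ofReal]
  refine Eventually.of_forall fun x h => ?_
  rintro rfl
  simp [invDensity, weight_zero hΦ hα hp] at h

/-- Every dilation orbit off the origin spends unit time in the annulus. -/
theorem volume_dilation_mem_annulus (hΦ : IsMinkowskiNorm Φ) (hΨ : IsMinkowskiNorm Ψ)
    (hα : 0 < α) {x : Space m k} (hx : x ≠ 0) :
    volume {s : ℝ | dilation α (-s) x ∈ annulus α Φ Ψ} = 1 := by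
  have hρ := dualGauge_pos hΦ hΨ hα hx
  have h : {s : ℝ | dilation α (-s) x ∈ annulus α Φ Ψ}
      = Set.Ioc (Real.log (dualGauge α Φ Ψ x) - 1) (Real.log (dualGauge α Φ Ψ x)) := by
    ext s
    have e : Real.exp (-s) * dualGauge α Φ Ψ x
        = Real.exp (Real.log (dualGauge α Φ Ψ x) - s) := by
      rw [sub_eq_neg_add, Real.exp_add, Real.exp_log hρ]
    simp only [annulus, Set.mem_ofPred_eq, dualGauge_dilation hΦ hΨ hα, e, Real.one_le_exp_iff,
      Real.exp_lt_exp, Set.mem_Ioc]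
    constructor <;> rintro ⟨h1, h2⟩ <;> constructor <;> linarith
  rw [h, Real.volume_Ioc]
  simp

/-- Integration in polar coordinates: the invariant measure is the product of its restriction to
the annulus with the Haar measure of the dilation group. -/
theorem lintegral_invMeasure_polar (hΦ : IsMinkowskiNorm Φ) (hΨ : IsMinkowskiNorm Ψ)
    (hα : 0 < α) (hp : 0 < p) {f : Space m k → ENNReal} (hf : Measurable f) :
    ∫⁻ x, f x ∂invMeasure α p Φ Ψ =
      ∫⁻ y in annulus α Φ Ψ, (∫⁻ s : ℝ, f (dilation α s y)) ∂invMeasure α p Φ Ψ := by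
  have hA := measurableSet_annulus hΦ hΨ hα
  have hdil := (continuous_dilation (α := α) (m := m) (k := k)).measurable
  have hind : Measurable ((annulus α Φ Ψ).indicator (fun _ => (1 : ENNReal))) :=
    measurable_const.indicator hA
  symm
  calc ∫⁻ y in annulus α Φ Ψ, (∫⁻ s : ℝ, f (dilation α s y)) ∂invMeasure α p Φ Ψ
      = ∫⁻ y, (∫⁻ s : ℝ, (annulus α Φ Ψ).indicator (fun _ => 1) y * f (dilation α s y))
          ∂invMeasure α p Φ Ψ := by
        rw [← lintegral_indicator hA]
        refine lintegral_congr fun y => ?_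
        by_cases hy : y ∈ annulus α Φ Ψ <;> simp [hy]
    _ = ∫⁻ s : ℝ, ∫⁻ y, (annulus α Φ Ψ).indicator (fun _ => 1) y * f (dilation α s y)
          ∂invMeasure α p Φ Ψ := by
        refine lintegral_lintegral_swap (Measurable.aemeasurable ?_)
        exact (hind.comp measurable_fst).mul (hf.comp (hdil.comp measurable_swap))
    _ = ∫⁻ s : ℝ, ∫⁻ y, (annulus α Φ Ψ).indicator (fun _ => 1) (dilation α (-s) y) * f y
          ∂invMeasure α p Φ Ψ := by
        refine lintegral_congr fun s => ?_
        rw [← lintegral_invMeasure_dilation hΦ hΨ hα s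
          (f := fun y => (annulus α Φ Ψ).indicator (fun _ => 1) (dilation α (-s) y) * f y)
          ((hind.comp (measurable_dilation _)).mul hf)]
        simp only [dilation_neg_dilation]
    _ = ∫⁻ y, (∫⁻ s : ℝ, (annulus α Φ Ψ).indicator (fun _ => 1) (dilation α (-s) y) * f y)
          ∂invMeasure α p Φ Ψ := by
        refine lintegral_lintegral_swap (Measurable.aemeasurable ?_)
        exact (hind.comp (hdil.comp (measurable_fst.neg.prodMk measurable_snd))).mul
          (hf.comp measurable_snd)
    _ = ∫⁻ y, f y ∂invMeasure α p Φ Ψ := by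
        refine lintegral_congr_ae ?_
        filter_upwards [ae_invMeasure_ne_zero hΦ hΨ hα hp] with y hy
        have hm : Measurable fun s : ℝ => dilation α (-s) y :=
          hdil.comp (measurable_neg.prodMk measurable_const)
        have : ∀ s : ℝ, (annulus α Φ Ψ).indicator (fun _ => (1 : ENNReal)) (dilation α (-s) y)
            = {s : ℝ | dilation α (-s) y ∈ annulus α Φ Ψ}.indicator 1 s := fun s => rfl
        have hm' : MeasurableSet {s : ℝ | dilation α (-s) y ∈ annulus α Φ Ψ} := hm hA
        simp_rw [this]
        rw [lintegral_mul_const _ (measurable_one.indicator hm'),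
          lintegral_indicator_one hm', volume_dilation_mem_annulus hΦ hΨ hα hy, one_mul]

theorem exists_norm_le_dualGauge (hΦ : IsMinkowskiNorm Φ) (hΨ : IsMinkowskiNorm Ψ)
    (hα : 0 < α) : ∃ C, 0 < C ∧ ∀ x : Space m k, ‖x.1‖ ≤ C * dualGauge α Φ Ψ x ∧
      ‖x.2‖ ≤ C * dualGauge α Φ Ψ x ^ (α + 1) := by
  obtain ⟨c, hc, h1⟩ := exists_norm_le_of_homogeneous hΦ.continuous_dualNorm hΦ.dualNorm_smul
    fun x hx => hΦ.dualNorm_pos hx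
  obtain ⟨d, hd, h2⟩ := exists_norm_le_of_homogeneous hΨ.continuous_dualNorm hΨ.dualNorm_smul
    fun x hx => hΨ.dualNorm_pos hx
  refine ⟨max c⁻¹ d⁻¹, by positivity, fun x => ⟨?_, ?_⟩⟩
  · have := (h1 x.1).trans (dualNorm_fst_le_dualGauge hΦ hΨ hα x)
    calc ‖x.1‖ ≤ c⁻¹ * dualGauge α Φ Ψ x := by
          rw [inv_mul_eq_div, le_div_iff₀ hc]
          linarith
      _ ≤ _ := mul_le_mul_of_nonneg_right (le_max_left _ _) (dualGauge_nonneg hΦ hΨ hα x)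
  · have := (h2 x.2).trans (dualNorm_snd_le_dualGauge hΦ hΨ hα x)
    calc ‖x.2‖ ≤ d⁻¹ * dualGauge α Φ Ψ x ^ (α + 1) := by
          rw [inv_mul_eq_div, le_div_iff₀ hd]
          linarith
      _ ≤ _ := mul_le_mul_of_nonneg_right (le_max_right _ _)
          (Real.rpow_nonneg (dualGauge_nonneg hΦ hΨ hα x) _)

theorem volume_dualGauge_lt_top (hΦ : IsMinkowskiNorm Φ) (hΨ : IsMinkowskiNorm Ψ)
    (hα : 0 < α) (R : ℝ) : volume {x : Space m k | dualGauge α Φ Ψ x < R} < ⊤ := by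
  obtain ⟨C, hC, h⟩ := exists_norm_le_dualGauge hΦ hΨ hα
  refine Metric.isBounded_iff_subset_closedBall 0 |>.mpr
    ⟨max (C * R) (C * R ^ (α + 1)), fun x hx => ?_⟩ |>.measure_lt_top
  have h0 := dualGauge_nonneg hΦ hΨ hα x
  have hx' : dualGauge α Φ Ψ x ≤ R := le_of_lt hx
  rw [mem_closedBall_zero_iff, Prod.norm_def]
  refine max_le_max ((h x).1.trans (by gcongr)) ((h x).2.trans ?_)
  gcongr

theorem homDim_nonneg (hα : 0 < α) : 0 ≤ homDim m k α := by
  unfold homDim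
  positivity

theorem invMeasure_annulus_lt_top (hΦ : IsMinkowskiNorm Φ) (hΨ : IsMinkowskiNorm Ψ)
    (hα : 0 < α) (hp : 0 < p) : invMeasure α p Φ Ψ (annulus α Φ Ψ) < ⊤ := by
  rw [invMeasure, withDensity_apply _ (measurableSet_annulus hΦ hΨ hα)]
  calc ∫⁻ x in annulus α Φ Ψ, ENNReal.ofReal (invDensity α p Φ Ψ x)
      ≤ ∫⁻ x in annulus α Φ Ψ, 1 := by
        refine setLIntegral_mono measurable_const fun x hx => ?_
        rw [ENNReal.ofReal_le_one]
        exact mul_le_one₀ (weight_le_one hΦ hΨ hα hp x)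
          (Real.rpow_nonneg (dualGauge_nonneg hΦ hΨ hα x) _)
          (Real.rpow_le_one_of_one_le_of_nonpos hx.1 (neg_nonpos.mpr (homDim_nonneg hα)))
    _ = volume (annulus α Φ Ψ) := by simp
    _ < ⊤ := (measure_mono fun x hx => hx.2).trans_lt (volume_dualGauge_lt_top hΦ hΨ hα _)

theorem lintegral_dualGauge_rpow (hΦ : IsMinkowskiNorm Φ) (hΨ : IsMinkowskiNorm Ψ)
    (hα : 0 < α) (hp : 0 < p) {a R : ℝ} (ha : 0 < a) (hR : 0 < R) :
    ∫⁻ x in {x : Space m k | dualGauge α Φ Ψ x < R}, ENNReal.ofReal (dualGauge α Φ Ψ x ^ a)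
      ∂invMeasure α p Φ Ψ =
    ENNReal.ofReal (R ^ a / a) * invMeasure α p Φ Ψ (annulus α Φ Ψ) := by
  have hρ := continuous_dualGauge hΦ hΨ hα
  have hB : MeasurableSet {x : Space m k | dualGauge α Φ Ψ x < R} :=
    measurableSet_lt hρ.measurable measurable_const
  rw [← lintegral_indicator hB, lintegral_invMeasure_polar hΦ hΨ hα hp
    ((hρ.measurable.pow_const a).ennreal_ofReal.indicator hB)]
  rw [← setLIntegral_const]
  refine setLIntegral_congr_fun (measurableSet_annulus hΦ hΨ hα) fun y hy => ?_
  have hy0 := dualGauge_pos hΦ hΨ hα (ne_zero_of_mem_annulus hΦ hΨ hα hy)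
  set r := dualGauge α Φ Ψ y
  have h1 : ∀ s : ℝ, {x : Space m k | dualGauge α Φ Ψ x < R}.indicator
      (fun x => ENNReal.ofReal (dualGauge α Φ Ψ x ^ a)) (dilation α s y)
      = (Set.Iio (Real.log (R / r))).indicator
        (fun s => ENNReal.ofReal (r ^ a * Real.exp (a * s))) s := fun s => by
    have h2 : dualGauge α Φ Ψ (dilation α s y) = Real.exp s * r := dualGauge_dilation hΦ hΨ hα s y
    have h3 : dilation α s y ∈ {x : Space m k | dualGauge α Φ Ψ x < R} ↔
        s ∈ Set.Iio (Real.log (R / r)) := by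
      rw [Set.mem_ofPred_eq, h2, Set.mem_Iio, Real.lt_log_iff_exp_lt (by positivity),
        lt_div_iff₀ hy0]
    simp only [Set.indicator_apply, h3, h2]
    rw [Real.mul_rpow (Real.exp_pos s).le hy0.le, ← Real.exp_mul, mul_comm s a, mul_comm]
  simp_rw [h1]
  rw [lintegral_indicator measurableSet_Iio, setLIntegral_congr Iio_ae_eq_Iic,
    ← ofReal_integral_eq_lintegral_ofReal ((integrableOn_exp_mul_Iic ha _).const_mul _)
      (Eventually.of_forall fun s => by positivity), integral_const_mul,
    integral_exp_mul_Iic ha]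
  congr 1
  rw [mul_comm a, Real.exp_mul, Real.exp_log (by positivity), Real.div_rpow hR.le hy0.le]
  field_simp

theorem integrableOn_weight (hΦ : IsMinkowskiNorm Φ) (hΨ : IsMinkowskiNorm Ψ)
    (hα : 0 < α) (hp : 0 < p) :
    IntegrableOn (weight α p Φ Ψ) {x : Space m k | dualGauge α Φ Ψ x < 1} := by
  refine Measure.integrableOn_of_bounded (M := 1) (volume_dualGauge_lt_top hΦ hΨ hα 1).ne
    (measurable_weight hΦ hΨ hα).aestronglyMeasurable (Eventually.of_forall fun x => ?_)
  rw [Real.norm_of_nonneg (weight_nonneg hΦ hΨ hα x)]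
  exact weight_le_one hΦ hΨ hα hp x

/-- The hyperplane `{z = 0}` is Lebesgue null. -/
theorem ae_fst_ne_zero (hm : 1 ≤ m) : ∀ᵐ x : Space m k, x.1 ≠ 0 := by
  have : Nonempty (Fin m) := ⟨⟨0, hm⟩⟩
  exact Measure.quasiMeasurePreserving_fst.ae (Measure.ae_ne volume 0)

theorem omega_pos (hm : 1 ≤ m) (hΦ : IsMinkowskiNorm Φ) (hΨ : IsMinkowskiNorm Ψ)
    (hα : 0 < α) (hp : 0 < p) : 0 < omega (m := m) (k := k) α p Φ Ψ := by
  have hopen : IsOpen {x : Space m k | dualGauge α Φ Ψ x < 1} :=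
    isOpen_lt (continuous_dualGauge hΦ hΨ hα) continuous_const
  have hvol : 0 < volume {x : Space m k | dualGauge α Φ Ψ x < 1} :=
    hopen.measure_pos _ ⟨0, by simp [dualGauge_zero hΦ hΨ hα]⟩
  unfold omega
  rw [setIntegral_pos_iff_support_of_nonneg_ae
    (Eventually.of_forall fun x => weight_nonneg hΦ hΨ hα x) (integrableOn_weight hΦ hΨ hα hp)]
  refine hvol.trans_eq (measure_congr ?_)
  filter_upwards [ae_fst_ne_zero hm] with x hx
  refine propext ⟨fun h => ⟨(weight_pos hΦ hΨ hα hx).ne', h⟩, fun h => h.2⟩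

theorem homDim_pos (hm : 1 ≤ m) (hα : 0 < α) : 0 < homDim m k α := by
  have : (1 : ℝ) ≤ m := by exact_mod_cast hm
  unfold homDim
  positivity

theorem sigma_pos (hm : 1 ≤ m) (hΦ : IsMinkowskiNorm Φ) (hΨ : IsMinkowskiNorm Ψ)
    (hα : 0 < α) (hp : 0 < p) : 0 < sigma (m := m) (k := k) α p Φ Ψ :=
  mul_pos (homDim_pos hm hα) (omega_pos hm hΦ hΨ hα hp)

theorem invDensity_mul_rpow (hΦ : IsMinkowskiNorm Φ) (hΨ : IsMinkowskiNorm Ψ)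
    (hα : 0 < α) (hp : 0 < p) (x : Space m k) :
    invDensity α p Φ Ψ x * dualGauge α Φ Ψ x ^ homDim m k α = weight α p Φ Ψ x := by
  by_cases hx : x = 0
  · subst hx
    simp [invDensity, weight_zero hΦ hα hp]
  · rw [invDensity, mul_assoc, ← Real.rpow_add (dualGauge_pos hΦ hΨ hα hx)]
    simp

/-- The mass of the annulus is the constant `σ_{α,p} = Q ω_{α,p}`. -/
theorem invMeasure_real_annulus (hm : 1 ≤ m) (hΦ : IsMinkowskiNorm Φ) (hΨ : IsMinkowskiNorm Ψ)
    (hα : 0 < α) (hp : 0 < p) :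
    (invMeasure (m := m) (k := k) α p Φ Ψ).real (annulus α Φ Ψ) = sigma α p Φ Ψ := by
  have hQ := homDim_pos (k := k) hm hα
  have hρ := continuous_dualGauge hΦ hΨ hα
  have hB : MeasurableSet {x : Space m k | dualGauge α Φ Ψ x < 1} :=
    measurableSet_lt hρ.measurable measurable_const
  have h1 := lintegral_dualGauge_rpow (m := m) (k := k) hΦ hΨ hα hp hQ one_pos
  rw [invMeasure, setLIntegral_withDensity_eq_setLIntegral_mul _
    (measurable_invDensity hΦ hΨ hα).ennreal_ofReal (hρ.measurable.pow_const _).ennreal_ofReal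
    hB, ← invMeasure] at h1
  have h2 : ∀ x : Space m k, ((fun x => ENNReal.ofReal (invDensity α p Φ Ψ x)) *
      fun x => ENNReal.ofReal (dualGauge α Φ Ψ x ^ homDim m k α)) x
      = ENNReal.ofReal (weight α p Φ Ψ x) := fun x => by
    rw [Pi.mul_apply, ← ENNReal.ofReal_mul (invDensity_nonneg hΦ hΨ hα x),
      invDensity_mul_rpow hΦ hΨ hα hp]
  simp_rw [h2] at h1
  rw [← ofReal_integral_eq_lintegral_ofReal (integrableOn_weight hΦ hΨ hα hp)
    (Eventually.of_forall fun x => weight_nonneg hΦ hΨ hα x), Real.one_rpow] at h1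
  change ENNReal.ofReal (omega α p Φ Ψ) = _ at h1
  have h3 := congrArg ENNReal.toReal h1
  rw [ENNReal.toReal_ofReal (omega_pos hm hΦ hΨ hα hp).le, ENNReal.toReal_mul,
    ENNReal.toReal_ofReal (by positivity)] at h3
  rw [sigma, h3, Measure.real]
  field_simp

theorem continuous_dilationField : Continuous (dilationField (m := m) (k := k) α) := by
  unfold dilationField
  fun_prop

/-- Near the origin the generator is `O(ρ)`, which the invariant measure integrates. -/
theorem integrableOn_dilationField (hΦ : IsMinkowskiNorm Φ) (hΨ : IsMinkowskiNorm Ψ)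
    (hα : 0 < α) (hp : 0 < p) {R : ℝ} (hR : 0 < R) :
    IntegrableOn (dilationField α) {x : Space m k | dualGauge α Φ Ψ x < R}
      (invMeasure α p Φ Ψ) := by
  obtain ⟨C, hC, h⟩ := exists_norm_le_dualGauge (m := m) (k := k) hΦ hΨ hα
  have hρ := continuous_dualGauge hΦ hΨ hα
  have hB : MeasurableSet {x : Space m k | dualGauge α Φ Ψ x < R} :=
    measurableSet_lt hρ.measurable measurable_const
  have hint : IntegrableOn (dualGauge α Φ Ψ) {x : Space m k | dualGauge α Φ Ψ x < R}
      (invMeasure α p Φ Ψ) := by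
    refine ⟨hρ.aestronglyMeasurable, ?_⟩
    rw [hasFiniteIntegral_iff_ofReal
      (Eventually.of_forall fun x => dualGauge_nonneg hΦ hΨ hα x)]
    have h1 := lintegral_dualGauge_rpow (m := m) (k := k) hΦ hΨ hα hp one_pos hR
    simp only [Real.rpow_one] at h1
    rw [h1]
    exact ENNReal.mul_lt_top ENNReal.ofReal_lt_top (invMeasure_annulus_lt_top hΦ hΨ hα hp)
  refine Integrable.mono' (hint.const_mul (max C ((α + 1) * (C * R ^ α))))
    continuous_dilationField.aestronglyMeasurable ?_
  filter_upwards [ae_restrict_mem hB] with x hx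
  have h0 := dualGauge_nonneg hΦ hΨ hα x
  have hx' : dualGauge α Φ Ψ x ≤ R := le_of_lt hx
  rw [Prod.norm_def]
  refine max_le ((h x).1.trans ?_) ?_
  · exact mul_le_mul_of_nonneg_right (le_max_left _ _) h0
  · have h4 : ‖(dilationField α x).2‖ ≤ (α + 1) * (C * dualGauge α Φ Ψ x ^ (α + 1)) := by
      rw [dilationField, norm_smul, Real.norm_of_nonneg (by positivity)]
      exact mul_le_mul_of_nonneg_left (h x).2 (by positivity)
    refine h4.trans ?_
    rw [Real.rpow_add_one' h0 (by positivity)]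
    calc (α + 1) * (C * (dualGauge α Φ Ψ x ^ α * dualGauge α Φ Ψ x))
        ≤ (α + 1) * (C * (R ^ α * dualGauge α Φ Ψ x)) := by gcongr
      _ = (α + 1) * (C * R ^ α) * dualGauge α Φ Ψ x := by ring
      _ ≤ _ := mul_le_mul_of_nonneg_right (le_max_right _ _) h0

/-- The polar decomposition as an identity of measures. -/
theorem map_dilation_prod (hΦ : IsMinkowskiNorm Φ) (hΨ : IsMinkowskiNorm Ψ)
    (hα : 0 < α) (hp : 0 < p) :
    (((invMeasure α p Φ Ψ).restrict (annulus α Φ Ψ)).prod (volume : Measure ℝ)).map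
      (fun q => dilation α q.2 q.1) = invMeasure (m := m) (k := k) α p Φ Ψ := by
  have hdil : Measurable fun q : Space m k × ℝ => dilation α q.2 q.1 :=
    (continuous_dilation (α := α) (m := m) (k := k)).measurable.comp measurable_swap
  refine Measure.ext_of_lintegral _ fun f hf => ?_
  have h := lintegral_prod _ (hf.comp hdil).aemeasurable
    (μ := (invMeasure α p Φ Ψ).restrict (annulus α Φ Ψ)) (ν := (volume : Measure ℝ))
  rw [lintegral_map hf hdil, lintegral_invMeasure_polar hΦ hΨ hα hp hf]
  exact h

/-- Along each dilation orbit the derivative of a test function integrates to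
`φ(∞) - φ(0) = -φ(0)`; the orbits are parametrized by the annulus, of mass `σ_{α,p}`. -/
theorem integral_fderiv_dilationField (hm : 1 ≤ m) (hΦ : IsMinkowskiNorm Φ)
    (hΨ : IsMinkowskiNorm Ψ) (hα : 0 < α) (hp : 0 < p) {φ : Space m k → ℝ}
    (hφ : ContDiff ℝ 1 φ) (hc : HasCompactSupport φ) :
    ∫ x, fderiv ℝ φ x (dilationField α x) ∂invMeasure α p Φ Ψ = -(sigma α p Φ Ψ * φ 0) := by
  have hρ := continuous_dualGauge hΦ hΨ hα
  have hf : Continuous fun x => fderiv ℝ φ x (dilationField α x) :=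
    (hφ.continuous_fderiv one_ne_zero).clm_apply continuous_dilationField
  obtain ⟨R, hR0, hR⟩ : ∃ R, 0 < R ∧ ∀ x ∈ tsupport φ, dualGauge α Φ Ψ x < R := by
    obtain ⟨R, hR⟩ := (hc.isCompact.image hρ).bddAbove
    refine ⟨max R 0 + 1, by positivity, fun x hx => ?_⟩
    have := hR ⟨x, hx, rfl⟩
    have := le_max_left R 0
    linarith
  obtain ⟨K, hK⟩ := (hφ.continuous_fderiv one_ne_zero).bounded_above_of_compact_support
    (hc.fderiv (𝕜 := ℝ))
  have hB : MeasurableSet {x : Space m k | dualGauge α Φ Ψ x < R} :=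
    measurableSet_lt hρ.measurable measurable_const
  have hint : Integrable (fun x => fderiv ℝ φ x (dilationField α x)) (invMeasure α p Φ Ψ) := by
    have h1 : IntegrableOn (fun x => fderiv ℝ φ x (dilationField α x))
        {x : Space m k | dualGauge α Φ Ψ x < R} (invMeasure α p Φ Ψ) :=
      Integrable.mono' ((integrableOn_dilationField hΦ hΨ hα hp hR0).norm.const_mul K)
        hf.aestronglyMeasurable (Eventually.of_forall fun x =>
          ((fderiv ℝ φ x).le_opNorm _).trans
            (mul_le_mul_of_nonneg_right (hK x) (norm_nonneg _)))
    refine (integrableOn_iff_integrable_of_support_subset fun x hx => ?_).mp h1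
    refine hR x (support_fderiv_subset ℝ fun h0 => hx ?_)
    simp [h0]
  have hdil : Measurable fun q : Space m k × ℝ => dilation α q.2 q.1 :=
    (continuous_dilation (α := α) (m := m) (k := k)).measurable.comp measurable_swap
  rw [← map_dilation_prod hΦ hΨ hα hp] at hint ⊢
  rw [integral_map hdil.aemeasurable hf.aestronglyMeasurable]
  have hint2 := hint.comp_measurable hdil
  simp only [Function.comp_def] at hint2
  rw [integral_prod _ hint2]
  have hinner : ∀ᵐ y ∂(invMeasure α p Φ Ψ).restrict (annulus α Φ Ψ),
      ∫ s, fderiv ℝ φ (dilation α s y) (dilationField α (dilation α s y)) = -φ 0 := by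
    filter_upwards [ae_restrict_mem (measurableSet_annulus hΦ hΨ hα), hint2.prod_right_ae]
      with y hy hy2
    have hy0 := dualGauge_pos hΦ hΨ hα (ne_zero_of_mem_annulus hΦ hΨ hα hy)
    have hlim0 : Tendsto (fun s => φ (dilation α s y)) atBot (𝓝 (φ 0)) :=
      (hφ.continuous.tendsto 0).comp (dilation_tendsto_zero hα y)
    have hlim1 : Tendsto (fun s => φ (dilation α s y)) atTop (𝓝 0) := by
      refine tendsto_const_nhds.congr' ?_
      have : Tendsto (fun s => Real.exp s * dualGauge α Φ Ψ y) atTop atTop :=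
        Real.tendsto_exp_atTop.atTop_mul_const hy0
      filter_upwards [this.eventually_ge_atTop R] with s hs
      symm
      refine image_eq_zero_of_notMem_tsupport fun hmem => ?_
      have := hR _ hmem
      rw [dualGauge_dilation hΦ hΨ hα] at this
      linarith
    rw [integral_of_hasDerivAt_of_tendsto (fun s =>
      ((hφ.differentiable one_ne_zero) (dilation α s y)).hasFDerivAt.comp_hasDerivAt s
        (hasDerivAt_dilation y s)) hy2 hlim0 hlim1, zero_sub]
  rw [integral_congr_ae hinner, setIntegral_const, invMeasure_real_annulus hm hΦ hΨ hα hp,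
    smul_eq_mul, mul_neg]

end Polar

/-! ### The flux of the fundamental solution -/

section Flux

variable {Φ : EuclideanSpace ℝ (Fin m) → ℝ} {Ψ : EuclideanSpace ℝ (Fin k) → ℝ} {α p : ℝ}

theorem gradient_eq_of_hasFDerivAt {n : ℕ} {f : EuclideanSpace ℝ (Fin n) → ℝ} {c : ℝ}
    {v x : EuclideanSpace ℝ (Fin n)} (h : HasFDerivAt f (c • innerSL ℝ v) x) :
    gradient f x = c • v := by
  refine HasGradientAt.gradient (hasGradientAt_iff_hasFDerivAt.mpr (h.congr_fderiv ?_))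
  ext w
  simp

theorem hasFDerivAt_dualNorm_rpow (hΦ : IsMinkowskiNorm Φ) (hα : 0 < α)
    (z : EuclideanSpace ℝ (Fin m)) :
    HasFDerivAt (fun z => dualNorm Φ z ^ (2 * (α + 1)))
      ((2 * (α + 1) * dualNorm Φ z ^ (2 * α)) • innerSL ℝ (legendreMap hΦ z)) z := by
  have h0 : ∀ z (a : ℝ), dualNorm Φ z ^ (2 * a) = (dualNorm Φ z ^ 2) ^ a := fun z a => by
    rw [Real.rpow_mul (hΦ.dualNorm_nonneg z), Real.rpow_two]
  simp_rw [h0]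
  refine ((hΦ.hasFDerivAt_dualNorm_sq z).rpow_const (Or.inr (by linarith))).congr_fderiv ?_
  rw [smul_smul, add_sub_cancel_right]
  congr 1
  ring

/-- The partial gradients of a function `g(ρ^{2(α+1)})` are multiples of the Legendre maps. -/
theorem gradZ_comp_dualGaugePow (hΦ : IsMinkowskiNorm Φ) (hα : 0 < α)
    {g : ℝ → ℝ} {g' : ℝ} {x : Space m k} (hg : HasDerivAt g g' (dualGaugePow α Φ Ψ x)) :
    gradZ (fun y => g (dualGaugePow α Φ Ψ y)) x =
      (2 * (α + 1) * g' * dualNorm Φ x.1 ^ (2 * α)) • legendreMap hΦ x.1 := by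
  refine gradient_eq_of_hasFDerivAt ?_
  have h := (hasFDerivAt_dualNorm_rpow hΦ hα x.1).add_const
    (4 * (α + 1) ^ 2 * dualNorm Ψ x.2 ^ 2)
  refine (hg.comp_hasFDerivAt x.1 h).congr_fderiv ?_
  rw [smul_smul]
  congr 1
  ring

theorem gradS_comp_dualGaugePow (hΨ : IsMinkowskiNorm Ψ)
    {g : ℝ → ℝ} {g' : ℝ} {x : Space m k} (hg : HasDerivAt g g' (dualGaugePow α Φ Ψ x)) :
    gradS (fun y => g (dualGaugePow α Φ Ψ y)) x =
      (2 * (α + 1) * g' * (4 * (α + 1))) • legendreMap hΨ x.2 := by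
  refine gradient_eq_of_hasFDerivAt ?_
  have h := ((hΨ.hasFDerivAt_dualNorm_sq x.2).const_mul (4 * (α + 1) ^ 2)).const_add
    (dualNorm Φ x.1 ^ (2 * (α + 1)))
  refine (hg.comp_hasFDerivAt x.2 h).congr_fderiv ?_
  rw [smul_smul, smul_smul]
  congr 1
  ring

theorem IsMinkowskiNorm.smul_gradient_smul_legendreMap {n : ℕ}
    {N : EuclideanSpace ℝ (Fin n) → ℝ} (hN : IsMinkowskiNorm N) (c : ℝ)
    (x : EuclideanSpace ℝ (Fin n)) :
    N (c • legendreMap hN x) • gradient N (c • legendreMap hN x) = c • x := by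
  rw [← hN.legendreMap_smul, hN.smul_gradient_legendreMap]

/-- The vector field `𝒜` of a function of `ρ` points along the generator of the dilations. -/
theorem fieldA_comp_dualGaugePow (hΦ : IsMinkowskiNorm Φ) (hΨ : IsMinkowskiNorm Ψ) (hα : 0 < α)
    {g : ℝ → ℝ} {g' : ℝ} {x : Space m k} (hg : HasDerivAt g g' (dualGaugePow α Φ Ψ x)) :
    fieldA α Φ Ψ (fun y => g (dualGaugePow α Φ Ψ y)) x =
      (2 * (α + 1) * g' * dualNorm Φ x.1 ^ (2 * α)) • dilationField α x := by
  rw [fieldA, gradZ_comp_dualGaugePow hΦ hα hg, gradS_comp_dualGaugePow hΨ hg,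
    hΦ.smul_gradient_smul_legendreMap, mul_smul (dualNorm Φ x.1 ^ (2 * α) / 4),
    hΨ.smul_gradient_smul_legendreMap]
  refine Prod.ext rfl ?_
  simp only [dilationField, Prod.smul_mk, smul_smul]
  congr 1
  ring

theorem energyDensity_comp_dualGaugePow (hΦ : IsMinkowskiNorm Φ) (hΨ : IsMinkowskiNorm Ψ)
    (hα : 0 < α) {g : ℝ → ℝ} {g' : ℝ} {x : Space m k} (hx : x.1 ≠ 0)
    (hg : HasDerivAt g g' (dualGaugePow α Φ Ψ x)) :
    energyDensity α Φ Ψ (fun y => g (dualGaugePow α Φ Ψ y)) x =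
      (2 * (α + 1) * g') ^ 2 * dualNorm Φ x.1 ^ (2 * α) * dualGaugePow α Φ Ψ x := by
  have hF := hΦ.dualNorm_pos hx
  rw [energyDensity, gradZ_comp_dualGaugePow hΦ hα hg, gradS_comp_dualGaugePow hΨ hg,
    hΦ.homogeneous, hΨ.homogeneous, ← hΦ.dualNorm_eq, ← hΨ.dualNorm_eq, mul_pow, mul_pow, sq_abs,
    sq_abs, dualGaugePow, mul_add 2 α 1, mul_one, Real.rpow_add hF, Real.rpow_two]
  ring

/-- The profile `g` with `𝒢_{α,p} = g(ρ^{2(α+1)})`. -/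
noncomputable def fundProfile (m k : ℕ) (α p C t : ℝ) : ℝ :=
  open Classical in
  if p = homDim m k α then -(C * (1 / (2 * (α + 1)) * Real.log t))
  else C * t ^ (1 / (2 * (α + 1)) * (-(homDim m k α - p) / (p - 1)))

theorem fundSol_eq (hΦ : IsMinkowskiNorm Φ) (hΨ : IsMinkowskiNorm Ψ) (hα : 0 < α) :
    fundSol α p Φ Ψ = fun x : Space m k =>
      fundProfile m k α p (fundConst (m := m) (k := k) α p Φ Ψ) (dualGaugePow α Φ Ψ x) := by
  have hα1 : 0 < α + 1 := by linarith
  funext x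
  have hP := dualGaugePow_nonneg (α := α) (Ψ := Ψ) hΦ x
  rw [fundSol, fundProfile, dualGauge_eq hΦ hΨ hα, ← Real.rpow_mul hP]
  rcases hP.eq_or_lt with h | h
  · rw [← h, Real.zero_rpow (by positivity)]
    simp
  · rw [Real.log_rpow h]

/-- Both cases of the definition of the constant give the same derivative of the profile. -/
theorem hasDerivAt_fundProfile (hα : 0 < α) (hp : 1 < p) {t : ℝ} (ht : 0 < t) :
    HasDerivAt (fundProfile m k α p (fundConst (m := m) (k := k) α p Φ Ψ))
      (-(1 / (2 * (α + 1)) * (sigma (m := m) (k := k) α p Φ Ψ ^ (-1 / (p - 1)) *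
        t ^ (1 / (2 * (α + 1)) * (-(homDim m k α - p) / (p - 1)) - 1)))) t := by
  have hα1 : 0 < α + 1 := by linarith
  have hp1 : 0 < p - 1 := by linarith
  unfold fundProfile fundConst
  by_cases h : p = homDim m k α
  · simp only [if_pos h]
    refine (((Real.hasDerivAt_log ht.ne').const_mul _).const_mul _).neg.congr_deriv ?_
    rw [← h]
    simp only [sub_self, neg_zero, zero_div, mul_zero, zero_sub, Real.rpow_neg_one]
    ring
  · simp only [if_neg h]
    refine ((Real.hasDerivAt_rpow_const (Or.inl ht.ne')).const_mul _).congr_deriv ?_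
    have : homDim m k α - p ≠ 0 := fun h' => h (by linarith)
    field_simp

/-- The bookkeeping of exponents behind the formula for the flux: `s = σ_{α,p}`, `F = Φ⁰(z)`,
`r = ρ`. -/
theorem flux_scalar_identity {s F r α p Q : ℝ} (hα : 0 < α) (hp : 1 < p) (hs : 0 < s)
    (hF : 0 < F) (hr : 0 < r) :
    ((s ^ (-1 / (p - 1)) * (r ^ (2 * (α + 1))) ^ (1 / (2 * (α + 1)) * (-(Q - p) / (p - 1)) - 1)) ^ 2
        * F ^ (2 * α) * r ^ (2 * (α + 1))) ^ ((p - 2) / 2) *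
      (s ^ (-1 / (p - 1)) * (r ^ (2 * (α + 1))) ^ (1 / (2 * (α + 1)) * (-(Q - p) / (p - 1)) - 1)
        * F ^ (2 * α)) = s⁻¹ * ((F / r) ^ (α * p) * r ^ (-Q)) := by
  have hα1 : α + 1 ≠ 0 := by linarith
  have hp1 : p - 1 ≠ 0 := by linarith
  obtain ⟨a, rfl⟩ : ∃ a, Real.exp a = s := ⟨_, Real.exp_log hs⟩
  obtain ⟨b, rfl⟩ : ∃ b, Real.exp b = F := ⟨_, Real.exp_log hF⟩
  obtain ⟨c, rfl⟩ : ∃ c, Real.exp c = r := ⟨_, Real.exp_log hr⟩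
  simp only [← Real.exp_mul, ← Real.exp_add, ← Real.exp_neg, ← Real.exp_sub, ← Real.exp_nat_mul]
  congr 1
  push_cast
  field_simp
  ring

/-- The flux of the fundamental solution is `-σ_{α,p}⁻¹ (Φ⁰(z)/ρ)^{αp} ρ^{-Q}` times the generator
of the dilations.  The null set `{z = 0}` is left out so that every base of a power is positive. -/
theorem flux_fundSol (hm : 1 ≤ m) (hΦ : IsMinkowskiNorm Φ) (hΨ : IsMinkowskiNorm Ψ)
    (hα : 0 < α) (hp : 1 < p) {x : Space m k} (hx : x.1 ≠ 0) :
    flux α p Φ Ψ (fundSol α p Φ Ψ) x =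
      -((sigma (m := m) (k := k) α p Φ Ψ)⁻¹ * invDensity α p Φ Ψ x) • dilationField α x := by
  have hα1 : α + 1 ≠ 0 := by linarith
  have hx0 : x ≠ 0 := fun h => hx (by rw [h]; rfl)
  have hs := sigma_pos (m := m) (k := k) hm hΦ hΨ hα (by linarith : 0 < p)
  have hg := hasDerivAt_fundProfile (m := m) (k := k) (Φ := Φ) (Ψ := Ψ) hα hp
    (dualGaugePow_pos hΦ hΨ hα hx0)
  have key := flux_scalar_identity (Q := homDim m k α) hα hp hs (hΦ.dualNorm_pos hx)
    (dualGauge_pos hΦ hΨ hα hx0)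
  rw [dualGauge_rpow hΦ hΨ hα] at key
  rw [flux, fundSol_eq hΦ hΨ hα, energyDensity_comp_dualGaugePow hΦ hΨ hα hx hg,
    fieldA_comp_dualGaugePow hΦ hΨ hα hg, smul_smul, invDensity, weight, ← key]
  congr 1
  have h2 : ∀ A : ℝ, 2 * (α + 1) * -(1 / (2 * (α + 1)) * A) = -A := fun A => by
    field_simp
  rw [h2, neg_sq]
  ring

end Flux

/-! ### The weak equation -/

section Weak

variable {Φ : EuclideanSpace ℝ (Fin m) → ℝ} {Ψ : EuclideanSpace ℝ (Fin k) → ℝ} {α p : ℝ}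

theorem contDiff_dualGaugePow (hΦ : IsMinkowskiNorm Φ) (hΨ : IsMinkowskiNorm Ψ) (hα : 0 < α) :
    ContDiff ℝ 1 (dualGaugePow α Φ Ψ) := by
  have h1 : dualGaugePow α Φ Ψ = fun x : Space m k =>
      (dualNorm Φ x.1 ^ 2) ^ (α + 1) + 4 * (α + 1) ^ 2 * dualNorm Ψ x.2 ^ 2 := by
    funext x
    rw [dualGaugePow, Real.rpow_mul (hΦ.dualNorm_nonneg _), Real.rpow_two]
  have h2 : ContDiff ℝ 1 fun x : Space m k => dualNorm Φ x.1 ^ 2 :=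
    hΦ.contDiff_dualNorm_sq.comp contDiff_fst
  have h3 : ContDiff ℝ 1 fun x : Space m k => dualNorm Ψ x.2 ^ 2 :=
    hΨ.contDiff_dualNorm_sq.comp contDiff_snd
  rw [h1]
  exact (h2.rpow_const_of_le (m := 1) (by push_cast; linarith)).add (contDiff_const.mul h3)

theorem contDiffOn_fundSol (hΦ : IsMinkowskiNorm Φ) (hΨ : IsMinkowskiNorm Ψ) (hα : 0 < α) :
    ContDiffOn ℝ 1 (fundSol (m := m) (k := k) α p Φ Ψ) {0}ᶜ := by
  have hP := (contDiff_dualGaugePow (m := m) (k := k) hΦ hΨ hα).contDiffOn (s := {0}ᶜ)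
  have hne : ∀ x ∈ ({0}ᶜ : Set (Space m k)), dualGaugePow α Φ Ψ x ≠ 0 := fun x hx =>
    (dualGaugePow_pos hΦ hΨ hα hx).ne'
  rw [fundSol_eq hΦ hΨ hα]
  unfold fundProfile
  by_cases h : p = homDim m k α
  · simp only [if_pos h]
    exact (contDiffOn_const.mul (contDiffOn_const.mul (hP.log hne))).neg
  · simp only [if_neg h]
    exact contDiffOn_const.mul (hP.rpow_const_of_ne hne)

theorem flux_fundSol_ae (hm : 1 ≤ m) (hΦ : IsMinkowskiNorm Φ) (hΨ : IsMinkowskiNorm Ψ)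
    (hα : 0 < α) (hp : 1 < p) :
    flux α p Φ Ψ (fundSol α p Φ Ψ) =ᵐ[volume] fun x : Space m k =>
      -((sigma (m := m) (k := k) α p Φ Ψ)⁻¹ * invDensity α p Φ Ψ x) • dilationField α x := by
  filter_upwards [ae_fst_ne_zero hm] with x hx
  exact flux_fundSol hm hΦ hΨ hα hp hx

theorem locallyIntegrable_flux_fundSol (hm : 1 ≤ m) (hΦ : IsMinkowskiNorm Φ)
    (hΨ : IsMinkowskiNorm Ψ) (hα : 0 < α) (hp : 1 < p) :
    LocallyIntegrable (flux α p Φ Ψ (fundSol (m := m) (k := k) α p Φ Ψ)) := by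
  intro x
  have hρ := continuous_dualGauge (m := m) (k := k) hΦ hΨ hα
  have hopen : IsOpen {y : Space m k | dualGauge α Φ Ψ y < dualGauge α Φ Ψ x + 1} :=
    isOpen_lt hρ continuous_const
  refine ⟨_, hopen.mem_nhds (by simp), ?_⟩
  have hR : 0 < dualGauge α Φ Ψ x + 1 := by
    have := dualGauge_nonneg hΦ hΨ hα x
    linarith
  have h := integrableOn_dilationField (m := m) (k := k) (p := p) hΦ hΨ hα (by linarith) hR
  rw [IntegrableOn, invMeasure, restrict_withDensity hopen.measurableSet,
    integrable_withDensity_iff_integrable_smul' (measurable_invDensity hΦ hΨ hα).ennreal_ofReal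
      (Eventually.of_forall fun _ => ENNReal.ofReal_lt_top)] at h
  refine (h.smul (-(sigma (m := m) (k := k) α p Φ Ψ)⁻¹)).congr ?_
  filter_upwards [ae_restrict_of_ae (flux_fundSol_ae hm hΦ hΨ hα hp)] with y hy
  rw [hy, Pi.smul_apply, ENNReal.toReal_ofReal (invDensity_nonneg hΦ hΨ hα y), smul_smul, neg_mul]

theorem inner_gradZ_add_inner_gradS {φ : Space m k → ℝ} {x : Space m k}
    (hφ : DifferentiableAt ℝ φ x) (v : Space m k) :
    inner ℝ v.1 (gradZ φ x) + inner ℝ v.2 (gradS φ x) = fderiv ℝ φ x v := by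
  have h1 : HasFDerivAt (fun z => φ (z, x.2)) _ x.1 :=
    HasFDerivAt.comp (g := φ) x.1 hφ.hasFDerivAt (hasFDerivAt_prodMk_left x.1 x.2)
  have h2 : HasFDerivAt (fun s => φ (x.1, s)) _ x.2 :=
    HasFDerivAt.comp (g := φ) x.2 hφ.hasFDerivAt (hasFDerivAt_prodMk_right x.1 x.2)
  rw [gradZ, gradS, gradient, gradient, real_inner_comm, real_inner_comm _ v.2,
    InnerProductSpace.toDual_symm_apply, InnerProductSpace.toDual_symm_apply, h1.fderiv, h2.fderiv,
    ContinuousLinearMap.comp_apply, ContinuousLinearMap.comp_apply, ← map_add]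
  simp

theorem weak_eq_fundSol (hm : 1 ≤ m) (hΦ : IsMinkowskiNorm Φ) (hΨ : IsMinkowskiNorm Ψ)
    (hα : 0 < α) (hp : 1 < p) {φ : Space m k → ℝ} (hφ : ContDiff ℝ 1 φ)
    (hc : HasCompactSupport φ) :
    ∫ x, (inner ℝ (flux α p Φ Ψ (fundSol α p Φ Ψ) x).1 (gradZ φ x) +
      inner ℝ (flux α p Φ Ψ (fundSol α p Φ Ψ) x).2 (gradS φ x)) = φ 0 := by
  have hp0 : 0 < p := by linarith
  have hs := sigma_pos (m := m) (k := k) hm hΦ hΨ hα hp0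
  have h := integral_fderiv_dilationField hm hΦ hΨ hα hp0 hφ hc
  rw [invMeasure, integral_withDensity_eq_integral_toReal_smul
    (measurable_invDensity hΦ hΨ hα).ennreal_ofReal
    (Eventually.of_forall fun _ => ENNReal.ofReal_lt_top)] at h
  have h2 : ∫ x, (inner ℝ (flux α p Φ Ψ (fundSol α p Φ Ψ) x).1 (gradZ φ x) +
      inner ℝ (flux α p Φ Ψ (fundSol α p Φ Ψ) x).2 (gradS φ x))
      = ∫ x, -(sigma (m := m) (k := k) α p Φ Ψ)⁻¹ *
        ((ENNReal.ofReal (invDensity α p Φ Ψ x)).toReal •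
          fderiv ℝ φ x (dilationField α x)) := by
    refine integral_congr_ae ?_
    filter_upwards [flux_fundSol_ae hm hΦ hΨ hα hp] with x hx
    rw [inner_gradZ_add_inner_gradS (hφ.differentiable one_ne_zero x), hx, map_smul,
      ENNReal.toReal_ofReal (invDensity_nonneg hΦ hΨ hα x), smul_eq_mul, smul_eq_mul]
    ring
  rw [h2, integral_const_mul, h]
  field_simp

theorem fundConst_pos (hm : 1 ≤ m) (hΦ : IsMinkowskiNorm Φ) (hΨ : IsMinkowskiNorm Ψ)
    (hα : 0 < α) (hp : 1 < p) (hpQ : p ≤ homDim m k α) :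
    0 < fundConst (m := m) (k := k) α p Φ Ψ := by
  have hs := sigma_pos (m := m) (k := k) hm hΦ hΨ hα (by linarith : 0 < p)
  unfold fundConst
  split_ifs with h
  · positivity
  · have h1 : 0 < homDim m k α - p := sub_pos.mpr (lt_of_le_of_ne hpQ h)
    have h2 : 0 < p - 1 := by linarith
    positivity

end Weak

end AnisoFinsler

theorem theorem1p2 {m k : ℕ} (hm : 1 ≤ m) (hk : 1 ≤ k)
    (Φ : EuclideanSpace ℝ (Fin m) → ℝ) (Ψ : EuclideanSpace ℝ (Fin k) → ℝ)
    (hΦ : AnisoFinsler.IsMinkowskiNorm Φ) (hΨ : AnisoFinsler.IsMinkowskiNorm Ψ)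
    (α p : ℝ) (hα : 0 < α) (hp : 1 < p) :
    IntegrableOn (AnisoFinsler.weight α p Φ Ψ)
      {x : AnisoFinsler.Space m k | AnisoFinsler.dualGauge α Φ Ψ x < 1} volume ∧
    0 < AnisoFinsler.omega α p Φ Ψ ∧
    (p ≤ AnisoFinsler.homDim m k α → 0 < AnisoFinsler.fundConst α p Φ Ψ) ∧
    AnisoFinsler.IsFundamentalSolution α p Φ Ψ 0 (AnisoFinsler.fundSol α p Φ Ψ) := by
  have hp0 : 0 < p := by linarith
  exact ⟨AnisoFinsler.integrableOn_weight hΦ hΨ hα hp0,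
    AnisoFinsler.omega_pos hm hΦ hΨ hα hp0,
    AnisoFinsler.fundConst_pos hm hΦ hΨ hα hp,
    AnisoFinsler.contDiffOn_fundSol hΦ hΨ hα,
    AnisoFinsler.locallyIntegrable_flux_fundSol hm hΦ hΨ hα hp,
    fun _ hφ hc => AnisoFinsler.weak_eq_fundSol hm hΦ hΨ hα hp (hφ.of_le (by simp)) hc⟩
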